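/- Let $U\subsetneq V$ be Grothendieck universes with $\omega\in U$. Call a set *$U$-small* if it is in bijection with an element of $U$, and call a category a *$U$-category* if all its Hom-sets are $U$-small; similarly for $V$. Let $F$ be a $U$-small field and $I$ a set that is $V$-small but not $U$-small. Let $\Lambda=F\langle I\rangle$ be the free associative $F$-algebra on $I$, and regard $F$ as the trivial $\Lambda$-module, on which every element of $I$ acts by $0$. Let $\mathcal A$ be the (abelian) category of $\Lambda$-modules $M$ that have a submodule $M'\subseteq M$ such that $M'$ and $M/M'$ are finite direct sums of copies of $F$. Let $\mathbf K^b(\mathcal A)$ be the homotopy category of bounded complexes in $\mathcal A$, let $\mathbf{Ac}^b(\mathcal A)$ be its triangulated subcategory of acyclic complexes, and let $Q\colon\mathbf K^b(\mathcal A)\to\mathbf D^b(\mathcal A)=\mathbf K^b(\mathcal A)/\mathbf{Ac}^b(\mathcal A)$ be the quotient functor onto the bounded derived category. For a triangulated category $\mathcal T$ let $h_{\mathcal T}\colon\mathcal T\to\operatorname{Ab}(\mathcal T)$ be its abelianisation, that is, the Yoneda embedding into the abelian category of coherent functors from $\mathcal T^{\mathrm{op}}$ to abelian groups (the cokernels of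 morphisms between representable functors). Let $\mathcal S=\operatorname{Ab}_{\mathrm{ac}}(\mathbf K^b(\mathcal A))$ be the Serre subcategory of $\operatorname{Ab}(\mathbf K^b(\mathcal A))$ generated by the objects $h(X)$ with $X\in\mathbf{Ac}^b(\mathcal A)$, and let $\operatorname{Ab}(\mathbf K^b(\mathcal A))/\mathcal S$ be the localisation of $\operatorname{Ab}(\mathbf K^b(\mathcal A))$ at the morphisms whose kernel and cokernel lie in $\mathcal S$. Then: 1. $\operatorname{Ab}(\mathbf K^b(\mathcal A))$ is a $U$-category. 2. There is an exact functor $\Phi\colon\operatorname{Ab}(\mathbf K^b(\mathcal A))\to\operatorname{Ab}(\mathbf D^b(\mathcal A))$ with $\Phi\circ h_{\mathbf K^b(\mathcal A)}\cong h_{\mathbf D^b(\mathcal A)}\circ Q$ which induces an equivalence $\operatorname{Ab}(\mathbf K^b(\mathcal A))/\mathcal S\simeq\operatorname{Ab}(\mathbf D^b(\mathcal A))$, and both of these categories are $V$-categories. 3. There are an $F$-linear isomorphism $\operatorname{Ext}^1_\Lambda(F,F)\cong F^I$ and an isomorphism of abelian groups $\operatorname{Hom}_{\mathbf D^b(\mathcal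 A)}(F,F[1])\cong F^I$. 4. The quotient $\operatorname{Ab}(\mathbf K^b(\mathcal A))/\mathcal S$ is not a $U$-category, and neither is $\operatorname{Ab}(\mathbf D^b(\mathcal A))$. -/

import Mathlib

open CategoryTheory Limits Preadditive
universe w

namespace CategoryTheory.Preadditive.RightFreyd

variable {V : Type*} [Category* V] [Preadditive V]

lemma map_eq_zero_iff_factors {u v : Arrow V} (f : u ⟶ v) :
    (quotient V).map f = 0 ↔ ∃ h : u.right ⟶ v.left, f.right = h ≫ v.hom := by
  rw [quotient_map_eq_zero_iff]
  constructor
  · rintro ⟨h⟩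
    exact ⟨h.hom, by simpa using h.comm⟩
  · rintro ⟨h, hh⟩
    exact ⟨⟨h, by simpa using hh⟩⟩

lemma map_eq_iff_factors {u v : Arrow V} (f g : u ⟶ v) :
    (quotient V).map f = (quotient V).map g ↔
      ∃ h : u.right ⟶ v.left, f.right - g.right = h ≫ v.hom := by
  rw [← sub_eq_zero, ← Functor.map_sub, map_eq_zero_iff_factors]
  rfl

lemma exists_quotient_obj_eq (X : RightFreyd V) : ∃ u, (quotient V).obj u = X := ⟨X.as, rfl⟩

instance hasZeroObject [HasZeroObject V] : HasZeroObject (RightFreyd V) :=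
  ⟨(functor V).obj (HasZeroObject.zero' V).zero,
    (functor V).map_isZero (isZero_zero V)⟩

instance hasFiniteProducts [HasZeroObject V] [HasBinaryBiproducts V] :
    HasFiniteProducts (RightFreyd V) := by
  have : HasBinaryBiproducts (Arrow V) := HasBinaryBiproducts.of_hasBinaryProducts
  have : HasBinaryBiproducts (RightFreyd V) := ⟨fun X Y ↦ by
    obtain ⟨u, rfl⟩ := exists_quotient_obj_eq X
    obtain ⟨v, rfl⟩ := exists_quotient_obj_eq Y
    have := preservesBinaryBiproducts_of_preservesBiproducts (quotient V)
    infer_instance⟩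
  exact hasFiniteProducts_of_has_binary_and_terminal

section Kernels

variable [HasBinaryBiproducts V] [HasWeakKernels V] {u v : Arrow V} (f : u ⟶ v)

lemma exists_kernel :
    ∃ (k : Arrow V) (i : k ⟶ u), (quotient V).map i ≫ (quotient V).map f = 0 ∧
      (∀ (t : Arrow V) (g : t ⟶ u), (quotient V).map (g ≫ f) = 0 →
        ∃ l : t ⟶ k, (quotient V).map (l ≫ i) = (quotient V).map g) ∧
      (∀ (t : Arrow V) (g : t ⟶ k), (quotient V).map (g ≫ i) = 0 → (quotient V).map g = 0) := by
  let α := biprod.desc f.right v.hom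
  let a := weakKernel.ι α ≫ biprod.fst
  let b := weakKernel.ι α ≫ biprod.snd
  have hab : a ≫ f.right + b ≫ v.hom = 0 := by
    have := weakKernel.condition α
    rw [← this]
    simp [a, b, α, biprod.desc_eq, -weakKernel.condition]
  let β := biprod.desc a u.hom
  let c := weakKernel.ι β ≫ biprod.fst
  let d := weakKernel.ι β ≫ biprod.snd
  have hcd : c ≫ a + d ≫ u.hom = 0 := by
    have := weakKernel.condition β
    rw [← this]
    simp [c, d, β, biprod.desc_eq, -weakKernel.condition]
  have lα : ∀ {W : V} (x : W ⟶ u.right) (y : W ⟶ v.left), x ≫ f.right + y ≫ v.hom = 0 →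
      ∃ l, l ≫ a = x ∧ l ≫ b = y := fun x y h ↦
    ⟨weakKernel.lift α (biprod.lift x y) (by simpa [α] using h), by simp [a], by simp [b]⟩
  have lβ : ∀ {W : V} (x : W ⟶ _) (y : W ⟶ u.left), x ≫ a + y ≫ u.hom = 0 →
      ∃ l, l ≫ c = x ∧ l ≫ d = y := fun x y h ↦
    ⟨weakKernel.lift β (biprod.lift x y) (by simpa [β] using h), by simp [c], by simp [d]⟩
  let k : Arrow V := Arrow.mk c
  let i : k ⟶ u := Arrow.homMk (-d) a (by
    have := eq_neg_of_add_eq_zero_left hcd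
    simp [k, this])
  refine ⟨k, i, ?_, fun t g hg ↦ ?_, fun t g hg ↦ ?_⟩
  · rw [← Functor.map_comp, map_eq_zero_iff_factors]
    exact ⟨-b, by simpa [i] using eq_neg_of_add_eq_zero_left hab⟩
  · rw [map_eq_zero_iff_factors] at hg
    obtain ⟨h, hh⟩ := hg
    obtain ⟨m, hm, -⟩ := lα g.right (-h) (by
      rw [Arrow.comp_right] at hh
      simp [hh])
    obtain ⟨n, hn, -⟩ := lβ (t.hom ≫ m) (-g.left) (by simp [hm])
    refine ⟨Arrow.homMk n m (by simp [k, hn]), ?_⟩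
    rw [map_eq_iff_factors]
    exact ⟨0, by simp [i, hm]⟩
  · rw [map_eq_zero_iff_factors] at hg ⊢
    obtain ⟨h, hh⟩ := hg
    obtain ⟨l, hl, -⟩ := lβ g.right (-h) (by
      simp only [i, Arrow.comp_right, Arrow.homMk_right] at hh
      simp [hh])
    exact ⟨l, hl.symm⟩

instance hasKernels : HasKernels (RightFreyd V) where
  has_limit {X Y} φ := by
    obtain ⟨u, rfl⟩ := exists_quotient_obj_eq X
    obtain ⟨v, rfl⟩ := exists_quotient_obj_eq Y
    obtain ⟨f, rfl⟩ := (quotient V).map_surjective φ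
    obtain ⟨k, i, w, h₁, h₂⟩ := exists_kernel f
    have : Mono ((quotient V).map i) := by
      rw [Preadditive.mono_iff_cancel_zero]
      intro T g hg
      obtain ⟨t, rfl⟩ := exists_quotient_obj_eq T
      obtain ⟨g, rfl⟩ := (quotient V).map_surjective g
      exact h₂ _ g (by rwa [Functor.map_comp])
    refine ⟨_, KernelFork.IsLimit.ofι' ((quotient V).map i) w (fun {T} g hg ↦ Nonempty.some ?_)⟩
    obtain ⟨t, rfl⟩ := exists_quotient_obj_eq T
    obtain ⟨g, rfl⟩ := (quotient V).map_surjective g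
    obtain ⟨l, hl⟩ := h₁ t g (by rwa [Functor.map_comp])
    exact ⟨⟨(quotient V).map l, by rwa [← Functor.map_comp]⟩⟩

variable [HasZeroObject V]

open ZeroObject

instance isNormalMonoCategory : IsNormalMonoCategory (RightFreyd V) where
  normalMonoOfMono {X Y} φ hφ := by
    obtain ⟨u, rfl⟩ := exists_quotient_obj_eq X
    obtain ⟨v, rfl⟩ := exists_quotient_obj_eq Y
    obtain ⟨f, rfl⟩ := (quotient V).map_surjective φ
    refine ⟨⟨_, (quotient V).map (Candidate.π f), (Candidate.cokernelCofork f).condition, ?_⟩⟩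
    refine KernelFork.IsLimit.ofι' _ _ (fun {T} g hg ↦ Nonempty.some ?_)
    obtain ⟨t, rfl⟩ := exists_quotient_obj_eq T
    obtain ⟨g, rfl⟩ := (quotient V).map_surjective g
    rw [← Functor.map_comp, map_eq_zero_iff_factors] at hg
    obtain ⟨h, hh⟩ := hg
    have e : g.right = (h ≫ biprod.fst) ≫ v.hom + (h ≫ biprod.snd) ≫ f.right := by
      simpa [Candidate.π, biprod.desc_eq] using hh
    let p : (Arrow.mk (0 : 0 ⟶ t.left)) ⟶ u :=
      Arrow.homMk 0 (t.hom ≫ h ≫ biprod.snd) (by simp)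
    have hp : (quotient V).map p = 0 := by
      rw [← cancel_mono ((quotient V).map f), zero_comp, ← Functor.map_comp,
        map_eq_zero_iff_factors]
      refine ⟨g.left - t.hom ≫ h ≫ biprod.fst, ?_⟩
      simp [p, e]
    rw [map_eq_zero_iff_factors] at hp
    obtain ⟨l, hl⟩ := hp
    let q : t ⟶ u := Arrow.homMk l (h ≫ biprod.snd) (by simpa [p] using hl.symm)
    refine ⟨⟨(quotient V).map q, ?_⟩⟩
    rw [← Functor.map_comp, map_eq_iff_factors]
    exact ⟨-(h ≫ biprod.fst), by simp [q, e]⟩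

instance isNormalEpiCategory : IsNormalEpiCategory (RightFreyd V) where
  normalEpiOfEpi {X Y} φ hφ := by
    obtain ⟨u, rfl⟩ := exists_quotient_obj_eq X
    obtain ⟨v, rfl⟩ := exists_quotient_obj_eq Y
    obtain ⟨f, rfl⟩ := (quotient V).map_surjective φ
    refine ⟨⟨_, kernel.ι ((quotient V).map f), kernel.condition _, ?_⟩⟩
    refine CokernelCofork.IsColimit.ofπ' _ _ (fun {T} g hg ↦ Nonempty.some ?_)
    obtain ⟨t, rfl⟩ := exists_quotient_obj_eq T
    obtain ⟨g, rfl⟩ := (quotient V).map_surjective g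
    have hπ : (quotient V).map (Candidate.π f) = 0 := by
      rw [← cancel_epi ((quotient V).map f), comp_zero]
      exact (Candidate.cokernelCofork f).condition
    rw [map_eq_zero_iff_factors] at hπ
    obtain ⟨h, hh⟩ := hπ
    obtain ⟨s, r, e⟩ : ∃ (s : v.right ⟶ v.left) (r : v.right ⟶ u.right),
        𝟙 v.right = s ≫ v.hom + r ≫ f.right :=
      ⟨h ≫ biprod.fst, h ≫ biprod.snd, by simpa [Candidate.π, biprod.desc_eq] using hh⟩
    have key : ∀ {W : V} (x : W ⟶ u.right) (y : W ⟶ v.left), x ≫ f.right = y ≫ v.hom →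
        ∃ l : W ⟶ t.left, x ≫ g.right = l ≫ t.hom := by
      intro W x y hxy
      let p : (Arrow.mk (0 : 0 ⟶ W)) ⟶ u := Arrow.homMk 0 x (by simp)
      have hp : (quotient V).map p ≫ (quotient V).map f = 0 := by
        rw [← Functor.map_comp, map_eq_zero_iff_factors]
        exact ⟨y, by simpa [p] using hxy⟩
      have hp' : (quotient V).map (p ≫ g) = 0 := by
        rw [Functor.map_comp, ← kernel.lift_ι _ _ hp, Category.assoc, hg, comp_zero]
      rw [map_eq_zero_iff_factors] at hp'
      simpa [p] using hp'
    have e' : r ≫ f.right = 𝟙 v.right - s ≫ v.hom := by rw [e]; abel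
    obtain ⟨l, hl⟩ := key (v.hom ≫ r) (𝟙 v.left - v.hom ≫ s) (by simp [e'])
    obtain ⟨l', hl'⟩ := key (f.right ≫ r - 𝟙 u.right) (-(f.right ≫ s)) (by simp [e'])
    refine ⟨⟨(quotient V).map (Arrow.homMk l (r ≫ g.right) (by simpa using hl.symm)), ?_⟩⟩
    rw [← Functor.map_comp, map_eq_iff_factors]
    exact ⟨l', by simpa using hl'⟩

end Kernels

noncomputable instance abelian [HasZeroObject V] [HasBinaryBiproducts V] [HasWeakKernels V] :
    Abelian (RightFreyd V) where

end CategoryTheory.Preadditive.RightFreyd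



section Modules

variable (F : Type w) [Field F] (I : Type w)

/-- The augmentation `F⟨I⟩ → F`, which sends every free generator to `0`. -/
noncomputable def augmentation : FreeAlgebra F I →ₐ[F] F :=
  FreeAlgebra.lift F (fun _ ↦ (0 : F))

/-- The trivial `F⟨I⟩`-module: the vector space `F`, on which every element of `I` acts by zero. -/
def TrivialModule : Type w := F

noncomputable instance : AddCommGroup (TrivialModule F) := inferInstanceAs (AddCommGroup F)

noncomputable instance : Module F (TrivialModule F) := inferInstanceAs (Module F F)

noncomputable instance : Module (FreeAlgebra F I) (TrivialModule F) :=
  Module.compHom F (augmentation F I).toRingHom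

/-- A module over `F⟨I⟩` which is a finite direct sum of copies of the trivial module. -/
def IsFiniteSumOfTrivial (M : Type w) [AddCommGroup M] [Module (FreeAlgebra F I) M] : Prop :=
  ∃ n : ℕ, Nonempty (M ≃ₗ[FreeAlgebra F I] (Fin n → TrivialModule F))

/-- The modules `M` over `F⟨I⟩` with a submodule `N` such that `N` and `M ⧸ N` are
finite direct sums of copies of the trivial module. -/
def isExtensionOfTrivial : ObjectProperty (ModuleCat.{w} (FreeAlgebra F I)) := fun M ↦
  ∃ N : Submodule (FreeAlgebra F I) M, IsFiniteSumOfTrivial F I N ∧ IsFiniteSumOfTrivial F I (M ⧸ N)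

variable {F I}

lemma trivialModule_smul (a : FreeAlgebra F I) (x : TrivialModule F) :
    a • x = augmentation F I a • x := rfl

instance : IsScalarTower F (FreeAlgebra F I) (TrivialModule F) where
  smul_assoc c a x := by
    rw [trivialModule_smul, trivialModule_smul, map_smul, smul_assoc]

instance : IsNoetherian (FreeAlgebra F I) (TrivialModule F) := by
  have : IsNoetherian F (TrivialModule F) := inferInstanceAs (IsNoetherian F F)
  exact isNoetherian_of_tower F this

lemma isFiniteSumOfTrivial_iff (M : Type w) [AddCommGroup M] [Module (FreeAlgebra F I) M] :
    IsFiniteSumOfTrivial F I M ↔ IsNoetherian (FreeAlgebra F I) M ∧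
      ∀ (a : FreeAlgebra F I), augmentation F I a = 0 → ∀ m : M, a • m = 0 := by
  constructor
  · rintro ⟨n, ⟨e⟩⟩
    refine ⟨isNoetherian_of_linearEquiv e.symm, fun a ha m ↦ e.injective ?_⟩
    rw [map_smul, map_zero]
    ext i
    simp [trivialModule_smul, ha]
  · rintro ⟨hN, h⟩
    let : Module F M := Module.compHom M (algebraMap F (FreeAlgebra F I))
    have : IsScalarTower F (FreeAlgebra F I) M :=
      ⟨fun c a m ↦ by rw [Algebra.smul_def, mul_smul]; rfl⟩
    have hs (a : FreeAlgebra F I) (m : M) : a • m = augmentation F I a • m := by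
      have := h (a - algebraMap F _ (augmentation F I a)) (by simp) m
      rw [sub_smul, sub_eq_zero, algebraMap_smul] at this
      exact this
    obtain ⟨S, hS⟩ := (inferInstance : Module.Finite (FreeAlgebra F I) M).fg_top
    have : Module.Finite F M := ⟨⟨S, by
      rw [eq_top_iff]
      rintro x -
      have hx : x ∈ Submodule.span (FreeAlgebra F I) (S : Set M) := by rw [hS]; trivial
      induction hx using Submodule.span_induction with
      | mem x hx => exact Submodule.subset_span hx
      | zero => exact zero_mem _
      | add x y _ _ hx hy => exact add_mem hx hy
      | smul a x _ hx => rw [hs]; exact Submodule.smul_mem _ _ hx⟩⟩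
    let e : M ≃ₗ[F] (Fin (Module.finrank F M) → F) := (Module.finBasis F M).equivFun
    refine ⟨Module.finrank F M, ⟨{ e.toAddEquiv with
      toFun := e
      map_smul' := fun a m ↦ ?_ }⟩⟩
    rw [hs, map_smul]
    rfl

lemma isExtensionOfTrivial_iff (M : ModuleCat.{w} (FreeAlgebra F I)) :
    isExtensionOfTrivial F I M ↔ IsNoetherian (FreeAlgebra F I) M ∧
      ∀ (a b : FreeAlgebra F I), augmentation F I a = 0 → augmentation F I b = 0 →
        ∀ m : M, a • b • m = 0 := by
  simp only [isExtensionOfTrivial, isFiniteSumOfTrivial_iff]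
  constructor
  · rintro ⟨N, ⟨hN, hN'⟩, hQ, hQ'⟩
    refine ⟨(isNoetherian_iff_submodule_quotient N).2 ⟨hN, hQ⟩, fun a b ha hb m ↦ ?_⟩
    have := hQ' b hb (N.mkQ m)
    rw [← map_smul, Submodule.mkQ_apply, Submodule.Quotient.mk_eq_zero] at this
    exact congr_arg Subtype.val (hN' a ha ⟨_, this⟩)
  · rintro ⟨hM, h⟩
    let N : Submodule (FreeAlgebra F I) M :=
      { carrier := {m | ∀ a : FreeAlgebra F I, augmentation F I a = 0 → a • m = 0}
        add_mem' := fun hx hy a ha ↦ by rw [smul_add, hx a ha, hy a ha, add_zero]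
        zero_mem' := fun a _ ↦ smul_zero a
        smul_mem' := fun c x hx a ha ↦ by
          rw [← mul_smul]
          exact hx _ (by rw [map_mul, ha, zero_mul]) }
    refine ⟨N, ⟨inferInstance, fun a ha m ↦ Subtype.ext (m.2 a ha)⟩, inferInstance, ?_⟩
    intro a ha m
    obtain ⟨m, rfl⟩ := N.mkQ_surjective m
    rw [← map_smul, Submodule.mkQ_apply, Submodule.Quotient.mk_eq_zero]
    exact fun b hb ↦ h b a hb ha m

instance : (isExtensionOfTrivial F I).IsClosedUnderSubobjects where
  prop_of_mono {X Y} f _ hY := by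
    rw [isExtensionOfTrivial_iff] at hY ⊢
    have hf : Function.Injective f.hom := (ModuleCat.mono_iff_injective f).1 inferInstance
    obtain ⟨_, h⟩ := hY
    exact ⟨isNoetherian_of_injective f.hom hf, fun a b ha hb m ↦ hf (by simp [h a b ha hb])⟩

instance : (isExtensionOfTrivial F I).IsClosedUnderQuotients where
  prop_of_epi {X Y} f _ hX := by
    rw [isExtensionOfTrivial_iff] at hX ⊢
    have hf : Function.Surjective f.hom := (ModuleCat.epi_iff_surjective f).1 inferInstance
    obtain ⟨_, h⟩ := hX
    refine ⟨isNoetherian_of_surjective f.hom (LinearMap.range_eq_top.2 hf),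
      fun a b ha hb m ↦ ?_⟩
    obtain ⟨m, rfl⟩ := hf m
    rw [← map_smul, ← map_smul, h a b ha hb, map_zero]

instance : (isExtensionOfTrivial F I).ContainsZero where
  exists_zero := ⟨ModuleCat.of _ PUnit, ModuleCat.isZero_of_subsingleton _, by
    rw [isExtensionOfTrivial_iff]
    exact ⟨inferInstance, fun _ _ _ _ _ ↦ rfl⟩⟩

instance : (isExtensionOfTrivial F I).IsClosedUnderBinaryProducts where
  limitsOfShape_le := by
    rintro X ⟨p⟩
    have h₁ := (isExtensionOfTrivial_iff _).1 (p.prop_diag_obj ⟨.left⟩)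
    have h₂ := (isExtensionOfTrivial_iff _).1 (p.prop_diag_obj ⟨.right⟩)
    let φ := (p.π.app ⟨.left⟩).hom.prod (p.π.app ⟨.right⟩).hom
    have hφ : Function.Injective φ := by
      intro m m' h
      have : ModuleCat.ofHom (LinearMap.toSpanSingleton (FreeAlgebra F I) X m) =
          ModuleCat.ofHom (LinearMap.toSpanSingleton (FreeAlgebra F I) X m') := by
        refine p.isLimit.hom_ext ?_
        rintro ⟨_ | _⟩
        · ext
          simpa using! congr_arg Prod.fst h
        · ext
          simpa using! congr_arg Prod.snd h
      simpa using! congr_arg (fun f ↦ f.hom (1 : FreeAlgebra F I)) this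
    obtain ⟨_, h₁⟩ := h₁
    obtain ⟨_, h₂⟩ := h₂
    rw [isExtensionOfTrivial_iff]
    refine ⟨isNoetherian_of_injective φ hφ, fun a b ha hb m ↦ hφ ?_⟩
    rw [map_smul, map_smul, map_zero]
    exact Prod.ext (h₁ a b ha hb _) (h₂ a b ha hb _)

instance : (isExtensionOfTrivial F I).IsClosedUnderFiniteProducts := .mk'

variable (F I) in
/-- The category of `F⟨I⟩`-modules that are extensions of finite sums of the trivial module. -/
abbrev ExtTriv := (isExtensionOfTrivial F I).FullSubcategory

lemma isExtensionOfTrivial_trivialModule :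
    isExtensionOfTrivial F I (ModuleCat.of (FreeAlgebra F I) (TrivialModule F)) := by
  rw [isExtensionOfTrivial_iff]
  refine ⟨inferInstanceAs (IsNoetherian (FreeAlgebra F I) (TrivialModule F)),
    fun a b ha _ m ↦ ?_⟩
  exact (trivialModule_smul a _).trans (by rw [ha, zero_smul])

variable (F I) in
/-- The trivial module as an object of `ExtTriv F I`. -/
noncomputable def trivialObject : ExtTriv F I :=
  ⟨ModuleCat.of (FreeAlgebra F I) (TrivialModule F), isExtensionOfTrivial_trivialModule⟩

end Modules

section Bounded

open ZeroObject

variable (C : Type*) [Category* C] [Abelian C]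

/-- The objects of the homotopy category which are (strictly) bounded complexes. -/
def boundedComplexes : ObjectProperty (HomotopyCategory C (.up ℤ)) := fun K ↦
  ∃ a b : ℤ, CochainComplex.IsStrictlyGE K.as a ∧ CochainComplex.IsStrictlyLE K.as b

variable {C} in
lemma boundedComplexes_quotient_obj_iff (K : CochainComplex C ℤ) :
    boundedComplexes C ((HomotopyCategory.quotient _ _).obj K) ↔
      ∃ a b : ℤ, K.IsStrictlyGE a ∧ K.IsStrictlyLE b := Iff.rfl

instance : (boundedComplexes C).ContainsZero where
  exists_zero :=
    ⟨(HomotopyCategory.quotient _ _).obj 0, Functor.map_isZero _ (isZero_zero _), by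
      rw [boundedComplexes_quotient_obj_iff]
      exact ⟨0, 0, inferInstance, inferInstance⟩⟩

instance : (boundedComplexes C).IsStableUnderShift ℤ where
  isStableUnderShiftBy n :=
    { le_shift K hK := by
        obtain ⟨K : CochainComplex _ _, rfl⟩ := K.quotient_obj_surjective
        rw [boundedComplexes_quotient_obj_iff] at hK
        obtain ⟨a, b, _, _⟩ := hK
        rw [ObjectProperty.prop_shift_iff, HomotopyCategory.shift_quotient_obj,
          boundedComplexes_quotient_obj_iff]
        exact ⟨a - n, b - n, K.isStrictlyGE_shift a n (a - n) (by lia),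
          K.isStrictlyLE_shift b n (b - n) (by lia)⟩ }

instance : (boundedComplexes C).IsTriangulatedClosed₃ where
  ext₃' T hT h₁ h₂ := by
    obtain ⟨a₁, b₁, _, _⟩ := h₁
    obtain ⟨a₂, b₂, _, _⟩ := h₂
    obtain ⟨f : T.obj₁.as ⟶ T.obj₂.as, hf⟩ :=
      (HomotopyCategory.quotient _ _).map_surjective T.mor₁
    refine ⟨_, ?_,
      ⟨Pretriangulated.Triangle.π₃.mapIso (Pretriangulated.isoTriangleOfIso₁₂ T _ hT
        (HomotopyCategory.mappingCone_triangleh_distinguished f)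
        (Iso.refl _) (Iso.refl _) ?_)⟩⟩
    · change boundedComplexes C ((HomotopyCategory.quotient _ _).obj (CochainComplex.mappingCone f))
      rw [boundedComplexes_quotient_obj_iff]
      refine ⟨min (a₁ - 1) a₂, max b₁ b₂, CochainComplex.isStrictlyGE_mappingCone f a₁ a₂ _
        (by simp) (by simp), ?_⟩
      rw [CochainComplex.isStrictlyLE_iff]
      intro i hi
      rw [CochainComplex.mappingCone.isZero_X_iff]
      exact ⟨CochainComplex.isZero_of_isStrictlyLE (T.obj₁.as : CochainComplex C ℤ) b₁ _,
        CochainComplex.isZero_of_isStrictlyLE (T.obj₂.as : CochainComplex C ℤ) b₂ _⟩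
    · exact (Category.comp_id _).trans (hf.symm.trans (Category.id_comp _).symm)

instance : (boundedComplexes C).IsTriangulated where
  toIsTriangulatedClosed₂ := .of_isTriangulatedClosed₃

/-- The homotopy category `K^b(C)` of bounded complexes, as a triangulated category. -/
abbrev BoundedHomotopyCategory := (boundedComplexes C).FullSubcategory

/-- The triangulated subcategory of `K^b(C)` of acyclic complexes. -/
abbrev boundedAcyclic : ObjectProperty (BoundedHomotopyCategory C) :=
  (HomotopyCategory.subcategoryAcyclic C).inverseImage (boundedComplexes C).ι

/-- The bounded derived category `D^b(C)`: the triangulated quotient of `K^b(C)` by the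
acyclic complexes, i.e. the localization at the morphisms whose cone is acyclic. -/
abbrev BoundedDerivedCategory := (boundedAcyclic C).trW.Localization

variable {C} in
/-- An object of `C`, viewed as a complex in degree `0`. -/
noncomputable def complexInDegreeZero (X : C) : BoundedHomotopyCategory C :=
  ⟨(HomotopyCategory.quotient _ _).obj ((HomologicalComplex.single C (.up ℤ) 0).obj X), by
    rw [boundedComplexes_quotient_obj_iff]
    exact ⟨0, 0, inferInstance, inferInstance⟩⟩

variable {C} in
/-- An object of `C`, viewed in `D^b(C)` as a complex in degree `0`. -/
noncomputable def inBoundedDerivedCategory (X : C) : BoundedDerivedCategory C :=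
  (boundedAcyclic C).trW.Q.obj (complexInDegreeZero X)

end Bounded

section Abelianisation

open Pretriangulated

/-- The abelianisation `Ab(T)` of a triangulated category `T`: the category of coherent functors
from `Tᵒᵖ` to abelian groups, i.e. of cokernels of morphisms between representable functors. It is
realized by adding formal cokernels to `T`: an object is a morphism `X₁ ⟶ X₀` of `T` (which stands
for the cokernel of `Hom(-, X₁) ⟶ Hom(-, X₀)`), and a morphism is a commutative square, up to
those squares whose component `X₀ ⟶ Y₀` factors through `Y₁ ⟶ Y₀`. It is abelian by
`RightFreyd.abelian`, since `T` has weak kernels. -/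
abbrev Abelianisation (T : Type*) [Category* T] [Preadditive T] := RightFreyd T

/-- The canonical fully faithful functor `T ⥤ Ab(T)`. -/
noncomputable abbrev toAbelianisation (T : Type*) [Category* T] [Preadditive T]
    [HasZeroObject T] : T ⥤ Abelianisation T := RightFreyd.functor T

instance (C : Type*) [Category* C] [Abelian C] :
    HasBinaryBiproducts (BoundedDerivedCategory C) :=
  Pretriangulated.instHasBinaryBiproducts

instance (C : Type*) [Category* C] [Abelian C] :
    HasWeakKernels (BoundedDerivedCategory C) :=
  Pretriangulated.instHasWeakKernels

end Abelianisation

section Serre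

open ZeroObject

variable {C : Type*} [Category* C] [Abelian C]

/-- The Serre subcategory generated by a class of objects. -/
def serreClosure (P : ObjectProperty C) : ObjectProperty C := fun X ↦
  ∀ S : ObjectProperty C, S.IsSerreClass → P ≤ S → S X

instance (P : ObjectProperty C) : (serreClosure P).IsSerreClass where
  exists_zero := ⟨0, isZero_zero C, fun S _ _ ↦ S.prop_of_isZero (isZero_zero C)⟩
  prop_of_mono f _ hY S hS h := S.prop_of_mono f (hY S hS h)
  prop_of_epi f _ hX S hS h := S.prop_of_epi f (hX S hS h)
  prop_X₂_of_shortExact hE h₁ h₃ S hS h :=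
    S.prop_X₂_of_shortExact hE (h₁ S hS h) (h₃ S hS h)

/-- The quotient category `C/S` by a Serre subcategory: the localization at the morphisms whose
kernel and cokernel belong to `S`. -/
abbrev SerreQuotient (S : ObjectProperty C) [S.IsSerreClass] := S.isoModSerre.Localization

/-- The quotient functor. -/
abbrev serreQuotientFunctor (S : ObjectProperty C) [S.IsSerreClass] : C ⥤ SerreQuotient S :=
  S.isoModSerre.Q

variable (C) in
/-- The Serre subcategory of `Ab(K^b(C))` generated by the acyclic complexes. -/
noncomputable def acyclicSerre : ObjectProperty (Abelianisation (BoundedHomotopyCategory C)) :=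
  serreClosure ((boundedAcyclic C).map (toAbelianisation (BoundedHomotopyCategory C)))

instance : (acyclicSerre C).IsSerreClass := inferInstanceAs (serreClosure _).IsSerreClass

end Serre

section Universes

/-- Grothendieck universes. -/
structure IsGrothendieckUniverse (U : ZFSet.{w}) : Prop where
  mem_of_mem : ∀ x ∈ U, ∀ y ∈ x, y ∈ U
  pair_mem : ∀ x ∈ U, ∀ y ∈ U, ({x, y} : ZFSet) ∈ U
  powerset_mem : ∀ x ∈ U, x.powerset ∈ U
  /-- The union of a family in `U` that is indexed by an element of `U` belongs to `U`. -/
  iUnion_mem : ∀ x ∈ U, ∀ f : {i // i ∈ x} → ZFSet.{w}, (∀ i, f i ∈ U) →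
    ∃ z ∈ U, ∀ y, y ∈ z ↔ ∃ i, y ∈ f i

/-- A type belongs to the universe `U` (up to bijection). -/
def IsSmallIn (U : ZFSet.{w}) (α : Type*) : Prop :=
  ∃ x ∈ U, Nonempty (α ≃ {y // y ∈ x})

/-- A `U`-category: all Hom-sets belong to `U` (up to bijection). -/
def IsUniverseCategory (U : ZFSet.{w}) (C : Type*) [Category* C] : Prop :=
  ∀ X Y : C, IsSmallIn U (X ⟶ Y)

end Universes

/-!
The theorem has three independent ingredients.

*Abelianisation and Verdier quotients.* For a triangulated category `T`, the functor
`h : T ⥤ Ab(T)` is the universal homological functor: an additive functor `F : T ⥤ A` to an abelian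
category extends to a right exact functor `RightFreyd.lift F : Ab(T) ⥤ A`, unique up to isomorphism,
and this extension is exact when `F` is homological (`RightFreyd.preservesFiniteLimits_lift`). If `N`
is a triangulated subcategory of `T`, then both `Ab(T/N)` and the quotient of `Ab(T)` by the Serre
subcategory generated by `N` are universal among the homological functors on `T` which vanish on
`N`. Comparing the two universal properties yields exact functors in both directions which are
inverse to each other (`serreQuotientEquivalence`).

*Extensions.* The augmentation ideal `K` of `Λ = F⟨I⟩` is generated by the elements of `I`, and the
derivations `Λ → F` show that `Hom_Λ(K, F) = F ^ I`. Since the morphisms `Λ → F` vanish on `K`, the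
long exact sequence of `0 → K → Λ → F → 0` gives `Ext¹_Λ(F, F) = F ^ I`
(`extOneTrivialModuleEquiv`). The inclusion of `A` in the category of all modules induces a
triangulated functor `G : D^b(A) ⥤ D(Λ)`, which is conservative. It is bijective on
`Hom(X, Y⟦1⟧)` for objects `X` and `Y` of `A` whenever all the extensions of `X` by `Y` belong to
`A` (`mapHomShift_boundedDerivedToDerived_bijective`): a morphism `X ⟶ Y⟦1⟧` of `D(Λ)` is the class
of an extension, which lies in `A`, and so comes from `D^b(A)`; if `φ : X ⟶ Y⟦1⟧` vanishes in
`D(Λ)`, then the extension of `X` by `Y` given by a cone of `φ` is an object of `A` and splits in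
the category of modules, hence in `A`, and `φ = 0`.

*Smallness.* An object of `A` is a finite set of copies of `F` with an action of `Λ`. Hence the Hom
sets of `A`, of `K^b(A)` and of `Ab(K^b(A))` are `U`-small. Up to isomorphism, the objects of `A`
and the bounded complexes form `V`-small sets, so that the fractions which describe the morphisms of
`D^b(A)` form `V`-small sets (`IsGrothendieckUniverse.isUniverseCategory_localization`). On the other
hand, `F ^ I = Hom(h(F), h(F⟦1⟧))` is a Hom set of `Ab(D^b(A))` which is not `U`-small, since `I`
embeds in it.
-/

/-! ### Extension of additive functors to the category of formal cokernels -/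

namespace CategoryTheory.Preadditive.RightFreyd

section Lift

variable {V : Type*} [Category* V] [Preadditive V] {D : Type*} [Category* D] [Preadditive D]
  [HasCokernels D]

/-- The extension to `RightFreyd V` of an additive functor `F : V ⥤ D` to a category with
cokernels: it sends the formal cokernel of `f` to the cokernel of `F.map f`. -/
noncomputable def lift (F : V ⥤ D) [F.Additive] : RightFreyd V ⥤ D :=
  CategoryTheory.Quotient.lift _ (F.mapArrow ⋙ coker D) (by
    rintro u v f g ⟨h⟩
    refine coequalizer.hom_ext ?_
    have := congr_arg F.map h.comm
    rw [F.map_sub, F.map_comp] at this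
    have e : F.map f.right ≫ cokernel.π (F.map v.hom) =
        F.map g.right ≫ cokernel.π (F.map v.hom) := by
      rw [← sub_eq_zero, ← Preadditive.sub_comp, this, Category.assoc, cokernel.condition,
        comp_zero]
    exact (cokernel.π_desc (F.map u.hom) _ _).trans
      (e.trans (cokernel.π_desc (F.map u.hom) _ _).symm))

variable (F : V ⥤ D) [F.Additive]

/-- The projection of `F.obj u.right` to the value of `lift F` at the formal cokernel of `u`. -/
noncomputable def liftπ (u : Arrow V) :
    F.obj u.right ⟶ (lift F).obj ((quotient V).obj u) :=
  cokernel.π (F.map u.hom)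

instance (u : Arrow V) : Epi (liftπ F u) := inferInstanceAs (Epi (cokernel.π (F.map u.hom)))

lemma map_hom_liftπ (u : Arrow V) : F.map u.hom ≫ liftπ F u = 0 := cokernel.condition _

lemma liftπ_map {u v : Arrow V} (f : u ⟶ v) :
    liftπ F u ≫ (lift F).map ((quotient V).map f) = F.map f.right ≫ liftπ F v :=
  cokernel.π_desc _ _ _

/-- The value of `lift F` at the formal cokernel of `u` is the cokernel of `F.map u.hom`. -/
noncomputable def isColimitLiftπ (u : Arrow V) :
    IsColimit (CokernelCofork.ofπ (liftπ F u) (map_hom_liftπ F u)) :=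
  cokernelIsCokernel (F.map u.hom)

instance : (lift F).Additive where
  map_add {X Y f g} := by
    obtain ⟨u, rfl⟩ := exists_quotient_obj_eq X
    obtain ⟨v, rfl⟩ := exists_quotient_obj_eq Y
    obtain ⟨f, rfl⟩ := (quotient V).map_surjective f
    obtain ⟨g, rfl⟩ := (quotient V).map_surjective g
    rw [← cancel_epi (liftπ F u), ← Functor.map_add, liftπ_map, comp_add, liftπ_map, liftπ_map,
      Arrow.Hom.add_right, Functor.map_add, add_comp]

lemma isIso_liftπ_of_hom_eq_zero (u : Arrow V) (hu : u.hom = 0) : IsIso (liftπ F u) :=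
  CokernelCofork.IsColimit.isIso_π (CokernelCofork.ofπ _ (map_hom_liftπ F _))
    (isColimitLiftπ F _) (by rw [hu, F.map_zero])

/-- `lift F` extends `F`. -/
noncomputable def functorCompLift [HasZeroObject V] : functor V ⋙ lift F ≅ F :=
  (NatIso.ofComponents (fun X ↦
    letI := isIso_liftπ_of_hom_eq_zero F ((rightFunctor V).obj X) rfl
    @asIso _ _ _ _ (liftπ F ((rightFunctor V).obj X)) this) (fun f ↦
      (liftπ_map F ((rightFunctor V).map f)).symm)).symm

lemma preservesCokernel_lift [HasBinaryBiproducts V] {X Y : RightFreyd V} (f : X ⟶ Y) :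
    PreservesColimit (parallelPair f 0) (lift F) := by
  obtain ⟨u, rfl⟩ := exists_quotient_obj_eq X
  obtain ⟨v, rfl⟩ := exists_quotient_obj_eq Y
  obtain ⟨f, rfl⟩ := (quotient V).map_surjective f
  refine preservesColimit_of_preserves_colimit_cocone (Candidate.isColimitCokernelCofork f)
    ((CokernelCofork.isColimitMapCoconeEquiv _ _).2 ?_)
  have hπ : liftπ F v ≫ (lift F).map ((quotient V).map (Candidate.π f)) =
      liftπ F (Candidate.cokernel f) := by
    rw [liftπ_map]
    exact (congr_arg (· ≫ _) (F.map_id _)).trans (Category.id_comp _)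
  have : Epi ((lift F).map ((quotient V).map (Candidate.π f))) :=
    epi_of_epi_fac hπ
  have w : (lift F).map ((quotient V).map f) ≫ (lift F).map ((quotient V).map (Candidate.π f)) =
      0 :=
    ((lift F).map_comp _ _).symm.trans
      ((congr_arg (lift F).map (Candidate.cokernelCofork f).condition).trans
        (Functor.map_zero _ _ _))
  refine @CokernelCofork.IsColimit.ofπ' _ _ _ _ _ _ _
    ((lift F).map ((quotient V).map (Candidate.π f))) w (fun {T} g hg ↦ Nonempty.some ?_) this
  have h₁ : F.map v.hom ≫ liftπ F v ≫ g = 0 := by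
    rw [← Category.assoc, map_hom_liftπ, zero_comp]
  have h₂ : F.map f.right ≫ liftπ F v ≫ g = 0 := by
    rw [← Category.assoc, ← liftπ_map, Category.assoc, hg, comp_zero]
  have h₃ : F.map (biprod.desc v.hom f.right) ≫ liftπ F v ≫ g = 0 := by
    rw [biprod.desc_eq, F.map_add, F.map_comp, F.map_comp, add_comp, Category.assoc,
      Category.assoc, h₁, h₂, comp_zero, comp_zero, add_zero]
  refine ⟨⟨(isColimitLiftπ F (Candidate.cokernel f)).desc
    (CokernelCofork.ofπ (liftπ F v ≫ g) h₃), ?_⟩⟩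
  rw [← cancel_epi (liftπ F v), ← Category.assoc]
  refine Eq.trans (congr_arg (· ≫ _) hπ) ?_
  exact (isColimitLiftπ F (Candidate.cokernel f)).fac _ WalkingParallelPair.one

end Lift

section Uniqueness

variable {V : Type*} [Category* V] [Preadditive V] [HasZeroObject V]

open ZeroObject in
/-- The morphism of arrows from `0 ⟶ X` to `u` given by a morphism `X ⟶ u.right`. -/
noncomputable def rightHom {X : V} {u : Arrow V} (f : X ⟶ u.right) :
    (rightFunctor V).obj X ⟶ u :=
  Arrow.homMk (0 : 0 ⟶ u.left) f (zero_comp.trans zero_comp.symm)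

/-- The canonical epimorphism from `u.right` to the formal cokernel of `u`. -/
noncomputable def ofRight (u : Arrow V) : (functor V).obj u.right ⟶ (quotient V).obj u :=
  (quotient V).map (rightHom (𝟙 u.right))

instance (u : Arrow V) : Epi (ofRight u) :=
  have : IsIso (rightHom (𝟙 u.right)).right := inferInstanceAs (IsIso (𝟙 u.right))
  epi_of_isIso_right _

lemma functor_map_comp_ofRight {X : V} {u : Arrow V} (f : X ⟶ u.right) :
    (functor V).map f ≫ ofRight u = (quotient V).map (rightHom f) := by
  refine ((quotient V).map_comp _ _).symm.trans ((map_eq_iff_factors _ _).2 ⟨0, ?_⟩)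
  rw [zero_comp, sub_eq_zero]
  exact Category.comp_id f

lemma functor_map_comp_ofRight_eq_zero_iff {X : V} {u : Arrow V} (f : X ⟶ u.right) :
    (functor V).map f ≫ ofRight u = 0 ↔ ∃ h : X ⟶ u.left, f = h ≫ u.hom := by
  rw [functor_map_comp_ofRight]
  exact map_eq_zero_iff_factors _

lemma exists_functor_map_comp_ofRight {X : V} {u : Arrow V}
    (f : (functor V).obj X ⟶ (quotient V).obj u) :
    ∃ g : X ⟶ u.right, (functor V).map g ≫ ofRight u = f := by
  obtain ⟨f, rfl⟩ := (quotient V).map_surjective f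
  refine ⟨f.right, ?_⟩
  refine (functor_map_comp_ofRight (X := X) f.right).trans
    ((map_eq_iff_factors _ _).2 ⟨0, ?_⟩)
  rw [zero_comp, sub_eq_zero]
  rfl

lemma map_hom_ofRight (u : Arrow V) : (functor V).map u.hom ≫ ofRight u = 0 :=
  (functor_map_comp_ofRight_eq_zero_iff _).2 ⟨𝟙 _, (Category.id_comp _).symm⟩

lemma ofRight_naturality {u v : Arrow V} (f : u ⟶ v) :
    ofRight u ≫ (quotient V).map f = (functor V).map f.right ≫ ofRight v := by
  rw [functor_map_comp_ofRight]
  refine ((quotient V).map_comp _ _).symm.trans ((map_eq_iff_factors _ _).2 ⟨0, ?_⟩)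
  rw [zero_comp, sub_eq_zero]
  exact Category.id_comp f.right

/-- If a morphism of `RightFreyd V` is a monomorphism, then every generalized element of `u.right`
that becomes zero in the formal cokernel of `v` is already zero in the formal cokernel of `u`. -/
lemma exists_of_mono {u v : Arrow V} (f : u ⟶ v) [Mono ((quotient V).map f)]
    {W : V} (x : W ⟶ u.right) (y : W ⟶ v.left) (h : x ≫ f.right = y ≫ v.hom) :
    ∃ l : W ⟶ u.left, x = l ≫ u.hom := by
  rw [← functor_map_comp_ofRight_eq_zero_iff, ← cancel_mono ((quotient V).map f), zero_comp,
    Category.assoc, ofRight_naturality, ← Category.assoc, ← Functor.map_comp,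
    functor_map_comp_ofRight_eq_zero_iff]
  exact ⟨y, h⟩

/-- Every object of `RightFreyd V` is the cokernel of the morphism of `V` that it stands for. -/
noncomputable def isColimitOfRight (u : Arrow V) :
    IsColimit (CokernelCofork.ofπ (ofRight u) (map_hom_ofRight u)) :=
  CokernelCofork.IsColimit.ofπ' _ _ (fun {T} g hg ↦ Nonempty.some (by
    obtain ⟨t, rfl⟩ := exists_quotient_obj_eq T
    obtain ⟨g, rfl⟩ := exists_functor_map_comp_ofRight g
    rw [← Category.assoc, ← Functor.map_comp, functor_map_comp_ofRight_eq_zero_iff] at hg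
    obtain ⟨h, hh⟩ := hg
    exact ⟨(quotient V).map (Arrow.homMk h g hh.symm), ofRight_naturality _⟩))

variable {D : Type*} [Category* D] [Preadditive D] (G₁ G₂ : RightFreyd V ⥤ D)
  [G₁.Additive] [G₂.Additive] [PreservesFiniteColimits G₁] [PreservesFiniteColimits G₂]

/-- Two right exact functors on `RightFreyd V` are isomorphic as soon as their
restrictions to `V` are. -/
noncomputable def isoOfFunctorCompIso (α : functor V ⋙ G₁ ≅ functor V ⋙ G₂) : G₁ ≅ G₂ := by
  have h₁ (u : Arrow V) := CokernelCofork.mapIsColimit _ (isColimitOfRight u) G₁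
  have h₂ (u : Arrow V) := CokernelCofork.mapIsColimit _ (isColimitOfRight u) G₂
  let e (u : Arrow V) : G₁.obj ((quotient V).obj u) ≅ G₂.obj ((quotient V).obj u) :=
    CokernelCofork.mapIsoOfIsColimit (h₁ u) (h₂ u)
      (Arrow.isoMk (α.app u.left) (α.app u.right) (α.hom.naturality u.hom).symm)
  have he (u : Arrow V) : G₁.map (ofRight u) ≫ (e u).hom =
    α.hom.app u.right ≫ G₂.map (ofRight u) := CokernelCofork.π_mapOfIsColimit (h₁ u) _ _
  refine NatIso.ofComponents (fun X ↦ e X.as) (fun {X Y} f ↦ ?_)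
  obtain ⟨u, rfl⟩ := exists_quotient_obj_eq X
  obtain ⟨v, rfl⟩ := exists_quotient_obj_eq Y
  obtain ⟨f, rfl⟩ := (quotient V).map_surjective f
  have : Epi (G₁.map (ofRight u)) := Cofork.IsColimit.epi (h₁ u)
  change G₁.map ((quotient V).map f) ≫ (e v).hom = (e u).hom ≫ G₂.map ((quotient V).map f)
  rw [← cancel_epi (G₁.map (ofRight u)), ← Category.assoc, ← G₁.map_comp, ofRight_naturality,
    G₁.map_comp, Category.assoc, he, reassoc_of% he, ← G₂.map_comp, ofRight_naturality,
    G₂.map_comp]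
  exact α.hom.naturality_assoc f.right _

end Uniqueness

end CategoryTheory.Preadditive.RightFreyd

/-! ### The abelianisation as the universal homological functor -/

namespace CategoryTheory.Preadditive.RightFreyd

section Triangulated

open Pretriangulated ZeroObject

variable {T : Type*} [Category* T] [Preadditive T] [HasZeroObject T] [HasShift T ℤ]
  [∀ n : ℤ, (shiftFunctor T n).Additive] [Pretriangulated T]

/-- The canonical functor from a triangulated category to its abelianisation is homological. -/
instance functor_isHomological : (functor T).IsHomological where
  exact S hS := by
    rw [ShortComplex.exact_iff_exact_up_to_refinements]
    suffices ∀ (u : Arrow T) (x : (quotient T).obj u ⟶ (functor T).obj S.obj₂),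
        x ≫ (functor T).map S.mor₂ = 0 → ∃ z : u.right ⟶ S.obj₁,
          ofRight u ≫ x = (functor T).map z ≫ (functor T).map S.mor₁ by
      intro A x hx
      obtain ⟨u, rfl⟩ := exists_quotient_obj_eq A
      obtain ⟨z, hz⟩ := this u x hx
      exact ⟨_, ofRight u, inferInstance, (functor T).map z, hz⟩
    intro u x hx
    obtain ⟨y, hy⟩ := (functor T).map_surjective (X := u.right) (Y := S.obj₂) (ofRight u ≫ x)
    obtain ⟨z, hz⟩ := S.coyoneda_exact₂ hS y ((functor T).map_injective (by
      rw [Functor.map_comp, hy, Functor.map_zero, Category.assoc, hx, comp_zero]))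
    exact ⟨z, by rw [← hy, hz, Functor.map_comp]⟩

variable {A : Type*} [Category* A] [Abelian A] (H : T ⥤ A) [H.IsHomological]

/-- If `f : u ⟶ v` represents a monomorphism, then an element `y` of `H.obj u.right` which goes to
zero in the cokernel of `H.map v.hom` satisfies `y ≫ H.map f.right = z ≫ H.map v.hom` for some `z`.
As `H` is homological, the pair `(y, -z)` comes from a weak kernel of `u.right ⊞ v.left ⟶ v.right`,
whose projection to `u.right` factors through `u.hom` because `f` is a monomorphism. -/
instance preservesMonomorphisms_lift : (lift H).PreservesMonomorphisms where
  preserves {X Y} φ hφ := by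
    obtain ⟨u, rfl⟩ := exists_quotient_obj_eq X
    obtain ⟨v, rfl⟩ := exists_quotient_obj_eq Y
    obtain ⟨f, rfl⟩ := (quotient T).map_surjective φ
    -- a weak kernel of `u.right ⊞ v.left ⟶ v.right`, which `H` sends to an exact sequence
    obtain ⟨K, i, δ, hK⟩ := distinguished_cocone_triangle₁ (biprod.desc f.right v.hom)
    have hi : (i ≫ biprod.fst) ≫ f.right = (-(i ≫ biprod.snd)) ≫ v.hom := by
      have : i ≫ biprod.desc f.right v.hom = 0 := comp_distTriang_mor_zero₁₂ _ hK
      rw [neg_comp, eq_neg_iff_add_eq_zero]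
      rwa [biprod.desc_eq, comp_add, ← Category.assoc, ← Category.assoc] at this
    obtain ⟨l, hl⟩ := exists_of_mono f _ _ hi
    rw [Preadditive.mono_iff_cancel_zero]
    intro P x hx
    obtain ⟨P', π, _, y, hy⟩ := surjective_up_to_refinements_of_epi (liftπ H u) x
    have hy' : (y ≫ H.map f.right) ≫ liftπ H v = 0 := by
      rw [Category.assoc, ← liftπ_map, ← reassoc_of% hy, hx, comp_zero]
    obtain ⟨P'', π', _, z, hz⟩ :=
      (CokernelCofork.IsColimit.comp_π_eq_zero_iff_up_to_refinements (isColimitLiftπ H v) _).1 hy'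
    let s : P'' ⟶ H.obj (u.right ⊞ v.left) :=
      π' ≫ y ≫ H.map biprod.inl - z ≫ H.map biprod.inr
    have hs : s ≫ H.map (biprod.desc f.right v.hom) = 0 := by
      simp only [s, sub_comp, Category.assoc, ← H.map_comp, biprod.inl_desc, biprod.inr_desc, hz,
        sub_self]
    obtain ⟨P₃, π₃, _, t, ht⟩ : ∃ (P₃ : A) (π₃ : P₃ ⟶ P'') (_ : Epi π₃) (t : P₃ ⟶ H.obj K),
        π₃ ≫ s = t ≫ H.map i := (H.map_distinguished_exact _ hK).exact_up_to_refinements s hs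
    have ht' : π₃ ≫ π' ≫ y = t ≫ H.map l ≫ H.map u.hom := by
      have := ht =≫ H.map biprod.fst
      simp only [s, sub_comp, comp_sub, Category.assoc, ← H.map_comp, biprod.inl_fst,
        biprod.inr_fst, H.map_zero, comp_zero, sub_zero, H.map_id, Category.comp_id] at this
      rw [this, ← H.map_comp, hl]
    rw [← cancel_epi π, ← cancel_epi π', ← cancel_epi π₃, hy, ← Category.assoc π',
      ← Category.assoc, ht', Category.assoc, Category.assoc, map_hom_liftπ, comp_zero, comp_zero,
      comp_zero, comp_zero, comp_zero]

instance preservesFiniteColimits_lift : PreservesFiniteColimits (lift H) :=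
  ((Functor.preservesFiniteColimits_tfae (lift H)).out 2 3).1
    (fun _ _ f ↦ preservesCokernel_lift H f)

/-- The universal property of the abelianisation: the extension to `RightFreyd T` of a
homological functor on `T` is exact. -/
instance preservesFiniteLimits_lift : PreservesFiniteLimits (lift H) :=
  (Functor.preservesFiniteLimits_iff_forall_exact_map_and_mono (lift H)).2 (fun S hS ↦
    have := hS.mono_f
    ⟨((Functor.preservesFiniteColimits_iff_forall_exact_map_and_epi (lift H)).1
      inferInstance S hS).1, inferInstance⟩)

end Triangulated

end CategoryTheory.Preadditive.RightFreyd

/-! ### Abelianisation of a Verdier quotient -/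

section VerdierQuotient

open Pretriangulated RightFreyd ObjectProperty ZeroObject

variable {T : Type*} [Category* T] [Preadditive T] [HasZeroObject T] [HasShift T ℤ]
  [∀ n : ℤ, (shiftFunctor T n).Additive] [Pretriangulated T]

/-- A homological functor that vanishes on a triangulated subcategory `N` inverts the morphisms
whose cone belongs to `N`. -/
lemma CategoryTheory.Functor.IsHomological.isInvertedBy_trW
    (N : ObjectProperty T) [N.IsTriangulated] {A : Type*} [Category* A] [Abelian A] (H : T ⥤ A)
    [H.IsHomological] (hH : ∀ X, N X → IsZero (H.obj X)) : N.trW.IsInvertedBy H := by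
  intro X Y s hs
  have hepi : Epi (H.map s) := by
    obtain ⟨Z, g, h, hT, hZ⟩ := N.trW_iff s |>.1 hs
    exact (H.map_distinguished_exact _ hT).epi_f ((hH _ hZ).eq_of_tgt _ _)
  have hmono : Mono (H.map s) := by
    obtain ⟨Z, g, h, hT, hZ⟩ := N.trW_iff' s |>.1 hs
    exact (H.map_distinguished_exact _ hT).mono_g ((hH _ hZ).eq_of_src _ _)
  exact isIso_of_mono_of_epi _

variable (N : ObjectProperty T) [N.IsTriangulated]

/-- The Serre subcategory of `Ab(T)` generated by the objects of a triangulated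
subcategory `N` of `T`. -/
abbrev abelianisationSerre : ObjectProperty (Abelianisation T) :=
  serreClosure (N.map (toAbelianisation T))

noncomputable instance : Abelian (SerreQuotient (abelianisationSerre N)) :=
  SerreClassLocalization.abelian (serreQuotientFunctor (abelianisationSerre N))
    (abelianisationSerre N)

instance : PreservesFiniteLimits (serreQuotientFunctor (abelianisationSerre N)) :=
  SerreClassLocalization.preservesFiniteLimits _ (abelianisationSerre N)

instance : PreservesFiniteColimits (serreQuotientFunctor (abelianisationSerre N)) :=
  SerreClassLocalization.preservesFiniteColimits _ (abelianisationSerre N)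

instance : (toAbelianisation T ⋙ serreQuotientFunctor (abelianisationSerre N)).IsHomological where
  exact S hS := ((toAbelianisation T).map_distinguished_exact S hS).map
    (serreQuotientFunctor (abelianisationSerre N))

lemma toAbelianisation_comp_serreQuotientFunctor_isInvertedBy :
    N.trW.IsInvertedBy (toAbelianisation T ⋙ serreQuotientFunctor (abelianisationSerre N)) :=
  Functor.IsHomological.isInvertedBy_trW N _ (fun X hX ↦
    (SerreClassLocalization.isZero_obj_iff (serreQuotientFunctor (abelianisationSerre N))
      (abelianisationSerre N) _).2
      (fun _ _ h ↦ h _ ⟨X, hX, ⟨Iso.refl _⟩⟩))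

variable [IsTriangulated T]

/-- The exact functor `Ab(T) ⥤ Ab(T/N)` induced by the Verdier quotient functor `T ⥤ T/N`. -/
noncomputable abbrev abelianisationQ : Abelianisation T ⥤ Abelianisation N.trW.Localization :=
  lift (N.trW.Q ⋙ toAbelianisation N.trW.Localization)

lemma preservesFiniteLimits_abelianisationQ : PreservesFiniteLimits (abelianisationQ N) :=
  inferInstance

lemma preservesFiniteColimits_abelianisationQ : PreservesFiniteColimits (abelianisationQ N) :=
  inferInstance

lemma isZero_Q_obj {X : T} (hX : N X) : IsZero (N.trW.Q.obj X) := by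
  have h : N.trW (0 : X ⟶ 0) := (N.trW_iff' _).2
    ⟨X, 𝟙 X, 0, contractible_distinguished X, hX⟩
  have := Localization.inverts N.trW.Q N.trW _ h
  exact (asIso (N.trW.Q.map (0 : X ⟶ 0))).isZero_iff.2 (N.trW.Q.map_isZero (isZero_zero T))

lemma abelianisationQ_isInvertedBy :
    (abelianisationSerre N).isoModSerre.IsInvertedBy (abelianisationQ N) := by
  rw [isoModSerre_isInvertedBy_iff]
  let P : ObjectProperty (Abelianisation N.trW.Localization) := IsZero
  have : P.IsSerreClass := inferInstanceAs (ObjectProperty.IsSerreClass IsZero)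
  intro X hX
  have hP : (P.inverseImage (abelianisationQ N)).IsSerreClass :=
    ObjectProperty.instIsSerreClassInverseImageOfPreservesFiniteLimitsOfPreservesFiniteColimits
      P (abelianisationQ N)
  refine hX _ hP ?_
  rintro X ⟨K, hK, ⟨e⟩⟩
  refine IsZero.of_iso ?_ ((abelianisationQ N).mapIso e.symm)
  refine IsZero.of_iso ?_ ((functorCompLift _).app K)
  exact (toAbelianisation _).map_isZero (isZero_Q_obj N hK)

/-- The functor `Ab(T)/⟨N⟩ ⥤ Ab(T/N)` induced by `abelianisationQ`. -/
noncomputable def serreQuotientToAbelianisation :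
    SerreQuotient (abelianisationSerre N) ⥤ Abelianisation N.trW.Localization :=
  Localization.lift (abelianisationQ N) (abelianisationQ_isInvertedBy N)
    (serreQuotientFunctor (abelianisationSerre N))

/-- `serreQuotientToAbelianisation` is induced by `abelianisationQ`. -/
noncomputable def serreQuotientFunctorCompIso :
    serreQuotientFunctor (abelianisationSerre N) ⋙ serreQuotientToAbelianisation N ≅
      abelianisationQ N :=
  Localization.fac _ _ _

/-- The functor `T/N ⥤ Ab(T)/⟨N⟩` induced by `T ⥤ Ab(T)`. -/
noncomputable def verdierQuotientToSerreQuotient :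
    N.trW.Localization ⥤ SerreQuotient (abelianisationSerre N) :=
  Localization.lift _ (toAbelianisation_comp_serreQuotientFunctor_isInvertedBy N) N.trW.Q

/-- `verdierQuotientToSerreQuotient` is induced by `T ⥤ Ab(T)`. -/
noncomputable def QCompVerdierQuotientToSerreQuotient :
    N.trW.Q ⋙ verdierQuotientToSerreQuotient N ≅
    toAbelianisation T ⋙ serreQuotientFunctor (abelianisationSerre N) :=
  Localization.fac _ _ _

instance : (verdierQuotientToSerreQuotient N).IsHomological :=
  have := Localization.essSurj_mapArrow N.trW.Q N.trW
  Functor.isHomological_of_localization N.trW.Q _ _ (QCompVerdierQuotientToSerreQuotient N)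

/-- The exact functor `Ab(T/N) ⥤ Ab(T)/⟨N⟩` which extends `verdierQuotientToSerreQuotient`. -/
noncomputable abbrev abelianisationToSerreQuotient :
    Abelianisation N.trW.Localization ⥤ SerreQuotient (abelianisationSerre N) :=
  lift (verdierQuotientToSerreQuotient N)

/-- The functor `Ab(T)/⟨N⟩ ⥤ Ab(T/N) ⥤ Ab(T)/⟨N⟩` is isomorphic to the identity, since both are
determined by their restriction to `T`. -/
noncomputable def serreQuotientUnitIso :
    𝟭 (SerreQuotient (abelianisationSerre N)) ≅
      serreQuotientToAbelianisation N ⋙ abelianisationToSerreQuotient N :=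
  let L := serreQuotientFunctor (abelianisationSerre N)
  let W := (abelianisationSerre N).isoModSerre
  let α : toAbelianisation T ⋙ L ≅
      toAbelianisation T ⋙ abelianisationQ N ⋙ abelianisationToSerreQuotient N :=
    (QCompVerdierQuotientToSerreQuotient N).symm ≪≫
      Functor.isoWhiskerLeft N.trW.Q (functorCompLift (verdierQuotientToSerreQuotient N)).symm ≪≫
      Functor.isoWhiskerRight (functorCompLift (N.trW.Q ⋙ toAbelianisation _)).symm
        (abelianisationToSerreQuotient N)
  let β : L ≅ abelianisationQ N ⋙ abelianisationToSerreQuotient N :=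
    isoOfFunctorCompIso _ _ α
  letI : Localization.Lifting L W (abelianisationQ N ⋙ abelianisationToSerreQuotient N)
      (serreQuotientToAbelianisation N ⋙ abelianisationToSerreQuotient N) :=
    ⟨(Functor.associator _ _ _).symm ≪≫ Functor.isoWhiskerRight (serreQuotientFunctorCompIso N) _⟩
  Localization.liftNatIso L W L (abelianisationQ N ⋙ abelianisationToSerreQuotient N)
    (𝟭 _) (serreQuotientToAbelianisation N ⋙ abelianisationToSerreQuotient N) β

/-- The functor `Ab(T/N) ⥤ Ab(T)/⟨N⟩ ⥤ Ab(T/N)` is isomorphic to the identity, since both are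
determined by their restriction to `T`. -/
noncomputable def serreQuotientCounitIso :
    abelianisationToSerreQuotient N ⋙ serreQuotientToAbelianisation N ≅ 𝟭 _ :=
  have : PreservesFiniteColimits (serreQuotientToAbelianisation N) :=
    (SerreClassLocalization.preservesFiniteColimits_comp_iff
      (serreQuotientFunctor (abelianisationSerre N)) (abelianisationSerre N) _).1
      (preservesFiniteColimits_of_natIso (serreQuotientFunctorCompIso N).symm)
  have : (serreQuotientToAbelianisation N).Additive :=
    have := preservesBinaryBiproducts_of_preservesBinaryCoproducts
      (serreQuotientToAbelianisation N)
    Functor.additive_of_preservesBinaryBiproducts _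
  let α : N.trW.Q ⋙ verdierQuotientToSerreQuotient N ⋙ serreQuotientToAbelianisation N ≅
      N.trW.Q ⋙ toAbelianisation _ :=
    Functor.isoWhiskerRight (QCompVerdierQuotientToSerreQuotient N) (serreQuotientToAbelianisation N) ≪≫
      Functor.isoWhiskerLeft (toAbelianisation T) (serreQuotientFunctorCompIso N) ≪≫
      functorCompLift (N.trW.Q ⋙ toAbelianisation _)
  let β : verdierQuotientToSerreQuotient N ⋙ serreQuotientToAbelianisation N ≅
      toAbelianisation _ :=
    Localization.liftNatIso N.trW.Q N.trW _ _ _ _ α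
  isoOfFunctorCompIso _ _
    (Functor.isoWhiskerRight (functorCompLift (verdierQuotientToSerreQuotient N))
      (serreQuotientToAbelianisation N) ≪≫ β ≪≫ (Functor.rightUnitor _).symm)

/-- For a triangulated subcategory `N` of `T`, the abelianisation of the Verdier quotient `T/N` is
the quotient of `Ab(T)` by the Serre subcategory generated by `N`. -/
noncomputable def serreQuotientEquivalence :
    SerreQuotient (abelianisationSerre N) ≌ Abelianisation N.trW.Localization :=
  .mk (serreQuotientToAbelianisation N) (abelianisationToSerreQuotient N)
    (serreQuotientUnitIso N) (serreQuotientCounitIso N)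

end VerdierQuotient

section AcyclicComplexes

variable (C : Type*) [Category* C] [Abelian C]

lemma exists_equivalence_serreQuotient_acyclicSerre :
    ∃ (Φ : Abelianisation (BoundedHomotopyCategory C) ⥤
        Abelianisation (BoundedDerivedCategory C))
      (e : SerreQuotient (acyclicSerre C) ≌ Abelianisation (BoundedDerivedCategory C)),
      PreservesFiniteLimits Φ ∧ PreservesFiniteColimits Φ ∧
      Nonempty (toAbelianisation (BoundedHomotopyCategory C) ⋙ Φ ≅
        (boundedAcyclic C).trW.Q ⋙ toAbelianisation (BoundedDerivedCategory C)) ∧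
      Nonempty (serreQuotientFunctor (acyclicSerre C) ⋙ e.functor ≅ Φ) :=
  ⟨abelianisationQ (boundedAcyclic C), serreQuotientEquivalence (boundedAcyclic C),
    preservesFiniteLimits_abelianisationQ _, preservesFiniteColimits_abelianisationQ _,
    ⟨RightFreyd.functorCompLift _⟩, ⟨serreQuotientFunctorCompIso _⟩⟩

end AcyclicComplexes

/-! ### Sets that are small with respect to a Grothendieck universe -/

section Smallness

variable {U : ZFSet.{w}} (hU : IsGrothendieckUniverse U)

include hU

namespace IsGrothendieckUniverse

lemma mem_of_subset {x y : ZFSet.{w}} (hx : x ∈ U) (h : y ⊆ x) : y ∈ U :=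
  hU.mem_of_mem _ (hU.powerset_mem x hx) _ (ZFSet.mem_powerset.2 h)

lemma isSmallIn_of_injective {α β : Type*} (hβ : IsSmallIn U β) (f : α → β)
    (hf : Function.Injective f) : IsSmallIn U α := by
  obtain ⟨x, hx, ⟨e⟩⟩ := hβ
  let y := ZFSet.sep (fun z ↦ ∃ a, (e (f a)).1 = z) x
  refine ⟨y, hU.mem_of_subset hx (ZFSet.sep_subset ..),
    ⟨Equiv.ofBijective (fun a ↦ ⟨(e (f a)).1, ZFSet.mem_sep.2 ⟨(e (f a)).2, a, rfl⟩⟩) ⟨?_, ?_⟩⟩⟩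
  · intro a b h
    exact hf (e.injective (Subtype.ext (congr_arg (fun z : {z // z ∈ y} ↦ z.1) h)))
  · rintro ⟨z, hz⟩
    obtain ⟨-, a, rfl⟩ := ZFSet.mem_sep.1 hz
    exact ⟨a, rfl⟩

lemma isSmallIn_of_surjective {α β : Type*} (hα : IsSmallIn U α) (f : α → β)
    (hf : Function.Surjective f) : IsSmallIn U β :=
  hU.isSmallIn_of_injective hα _ (Function.injective_surjInv hf)

lemma exists_mem_subset_subset {x y : ZFSet.{w}} (hx : x ∈ U) (hy : y ∈ U) :
    ∃ z ∈ U, x ⊆ z ∧ y ⊆ z := by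
  obtain ⟨z, hz, h⟩ := hU.iUnion_mem _ (hU.pair_mem x hx y hy) Subtype.val (by
    rintro ⟨i, hi⟩
    obtain rfl | rfl := ZFSet.mem_pair.1 hi <;> assumption)
  exact ⟨z, hz, fun t ht ↦ (h t).2 ⟨⟨x, ZFSet.mem_pair.2 (.inl rfl)⟩, ht⟩,
    fun t ht ↦ (h t).2 ⟨⟨y, ZFSet.mem_pair.2 (.inr rfl)⟩, ht⟩⟩

lemma isSmallIn_prod {α β : Type*} (hα : IsSmallIn U α) (hβ : IsSmallIn U β) :
    IsSmallIn U (α × β) := by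
  obtain ⟨x, hx, ⟨e⟩⟩ := hα
  obtain ⟨y, hy, ⟨e'⟩⟩ := hβ
  obtain ⟨z, hz, hxz, hyz⟩ := hU.exists_mem_subset_subset hx hy
  have h : z.prod z ∈ U := by
    have hz' : z ∪ z ∈ U := hU.mem_of_subset hz (fun t ht ↦ by simpa using ht)
    refine hU.mem_of_subset (hU.powerset_mem _ (hU.powerset_mem _ hz')) ?_
    intro t ht
    obtain ⟨a, ha, b, hb, rfl⟩ := ZFSet.mem_prod.1 ht
    rw [ZFSet.mem_powerset]
    intro s hs
    rw [ZFSet.mem_powerset]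
    intro r hr
    grind [ZFSet.pair, ZFSet.mem_pair, ZFSet.mem_singleton, ZFSet.mem_union]
  refine hU.isSmallIn_of_injective ⟨_, h, ⟨Equiv.refl _⟩⟩
    (fun p ↦ ⟨ZFSet.pair (e p.1).1 (e' p.2).1,
      ZFSet.pair_mem_prod.2 ⟨hxz (e p.1).2, hyz (e' p.2).2⟩⟩) ?_
  rintro ⟨a, b⟩ ⟨a', b'⟩ h
  obtain ⟨h₁, h₂⟩ := ZFSet.pair_inj.1 (congr_arg Subtype.val h)
  exact Prod.ext (e.injective (Subtype.ext h₁)) (e'.injective (Subtype.ext h₂))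

lemma isSmallIn_set {α : Type*} (hα : IsSmallIn U α) : IsSmallIn U (Set α) := by
  obtain ⟨x, hx, ⟨e⟩⟩ := hα
  refine hU.isSmallIn_of_injective ⟨_, hU.powerset_mem x hx, ⟨Equiv.refl _⟩⟩
    (fun s ↦ ⟨ZFSet.sep (fun z ↦ ∃ a ∈ s, (e a).1 = z) x,
      ZFSet.mem_powerset.2 (ZFSet.sep_subset ..)⟩) ?_
  suffices ∀ s t : Set α, ZFSet.sep (fun z ↦ ∃ a ∈ s, (e a).1 = z) x =
      ZFSet.sep (fun z ↦ ∃ a ∈ t, (e a).1 = z) x → s ⊆ t from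
    fun s t h ↦ (this s t (congr_arg Subtype.val h)).antisymm
      (this t s (congr_arg Subtype.val h.symm))
  intro s t h a ha
  have h' : (e a).1 ∈ ZFSet.sep (fun z ↦ ∃ a ∈ s, (e a).1 = z) x :=
    ZFSet.mem_sep.2 ⟨(e a).2, a, ha, rfl⟩
  rw [h] at h'
  obtain ⟨-, b, hb, hab⟩ := ZFSet.mem_sep.1 h'
  rwa [← e.injective (Subtype.ext hab)]

lemma isSmallIn_fun {α β : Type*} (hα : IsSmallIn U α) (hβ : IsSmallIn U β) :
    IsSmallIn U (α → β) :=
  hU.isSmallIn_of_injective (hU.isSmallIn_set (hU.isSmallIn_prod hα hβ))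
    (fun f ↦ {p | f p.1 = p.2}) (fun f g h ↦ by
      ext a
      exact ((Set.ext_iff.1 h (a, f a)).1 rfl).symm)

lemma isSmallIn_sigma {α : Type*} {β : α → Type*} (hα : IsSmallIn U α)
    (hβ : ∀ a, IsSmallIn U (β a)) : IsSmallIn U (Σ a, β a) := by
  have hα' := hα
  obtain ⟨x, hx, ⟨e⟩⟩ := hα
  choose y hy e' using hβ
  obtain ⟨z, hz, h⟩ := hU.iUnion_mem x hx (fun i ↦ y (e.symm i)) (fun i ↦ hy _)
  refine hU.isSmallIn_of_injective (hU.isSmallIn_prod hα' ⟨z, hz, ⟨Equiv.refl _⟩⟩)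
    (fun p ↦ ⟨p.1, ⟨((e' p.1).some p.2).1, (h _).2 ⟨e p.1, by
      rw [e.symm_apply_apply]; exact ((e' p.1).some p.2).2⟩⟩⟩) ?_
  rintro ⟨a, b⟩ ⟨a', b'⟩ h
  obtain rfl : a = a' := congr_arg Prod.fst h
  have h₂ := congr_arg (fun p ↦ p.2.1) h
  exact congr_arg (Sigma.mk a) ((e' a).some.injective (Subtype.ext h₂))

lemma isSmallIn_nat (hω : ZFSet.omega ∈ U) : IsSmallIn U ℕ := by
  let f : ℕ → ZFSet.{w} := fun n ↦ n.rec ∅ (fun _ x ↦ insert x x)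
  have hf (n : ℕ) : f n ∈ ZFSet.omega := by
    induction n with
    | zero => exact ZFSet.omega_zero
    | succ n hn => exact ZFSet.omega_succ hn
  have hlt (m n : ℕ) (h : m < n) : f m ∈ f n := by
    induction n, h using Nat.le_induction with
    | base => exact ZFSet.mem_insert _ _
    | succ n _ hn => exact ZFSet.mem_insert_of_mem _ hn
  refine hU.isSmallIn_of_injective ⟨_, hω, ⟨Equiv.refl _⟩⟩ (fun n ↦ ⟨f n, hf n⟩) ?_
  intro m n h
  have h : f m = f n := congr_arg Subtype.val h
  by_contra hne
  obtain hmn | hmn := lt_or_gt_of_ne hne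
  · exact ZFSet.mem_irrefl _ (h ▸ hlt m n hmn)
  · exact ZFSet.mem_irrefl _ (h ▸ hlt n m hmn)

lemma isSmallIn_of_countable (hω : ZFSet.omega ∈ U) (α : Type*) [Countable α] : IsSmallIn U α := by
  obtain ⟨f, hf⟩ := exists_injective_nat α
  exact hU.isSmallIn_of_injective (hU.isSmallIn_nat hω) f hf

end IsGrothendieckUniverse

end Smallness

/-! ### Self-extensions of the trivial module over a free algebra -/

section FirstExt

open Abelian

/-- If `0 → X₁ → X₂ → X₃ → 0` is short exact, `X₂` is projective and every morphism from `X₂` to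
`Y` vanishes on `X₁`, then the connecting morphism `Hom(X₁, Y) → Ext¹(X₃, Y)` is bijective. -/
noncomputable def CategoryTheory.ShortComplex.ShortExact.homEquivExtOne
    {C : Type*} [Category* C] [Abelian C] [HasExt.{w} C] (R : Type*) [Ring R] [Linear R C]
    {S : ShortComplex C} (hS : S.ShortExact) [Projective S.X₂] {Y : C}
    (h : ∀ g : S.X₂ ⟶ Y, S.f ≫ g = 0) : (S.X₁ ⟶ Y) ≃ₗ[R] Ext.{w} S.X₃ Y 1 :=
  LinearEquiv.ofBijective
    { toFun := fun f ↦ hS.extClass.comp (Ext.mk₀ f) (add_zero 1)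
      map_add' := fun f g ↦ by rw [Ext.mk₀_add, Ext.comp_add]
      map_smul' := fun c f ↦ by rw [Ext.mk₀_smul, Ext.comp_smul, RingHom.id_apply] } (by
    constructor
    · rw [injective_iff_map_eq_zero]
      intro f hf
      obtain ⟨x, hx⟩ := Ext.contravariant_sequence_exact₁ hS _ _ (add_zero 1) hf
      obtain ⟨g, rfl⟩ := (Ext.mk₀_bijective _ _).2 x
      rw [Ext.mk₀_comp_mk₀, h, Ext.mk₀_zero] at hx
      exact (Ext.mk₀_bijective _ _).1 (hx.symm.trans (Ext.mk₀_zero ..).symm)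
    · intro x
      obtain ⟨y, hy⟩ := Ext.contravariant_sequence_exact₃ hS _ x
        (Ext.eq_zero_of_projective _) (add_zero 1)
      obtain ⟨g, rfl⟩ := (Ext.mk₀_bijective _ _).2 y
      exact ⟨g, hy⟩)

variable (F : Type w) [Field F] (I : Type w)

/-- The augmentation as a morphism of left modules from the free module of rank one to the trivial
module. -/
noncomputable def augmentationLinear : FreeAlgebra F I →ₗ[FreeAlgebra F I] TrivialModule F where
  toFun := augmentation F I
  map_add' := map_add _
  map_smul' a b := by
    have h : augmentation F I (a * b) = augmentation F I a * augmentation F I b := map_mul _ a b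
    exact h

/-- The augmentation ideal, as a left ideal. -/
noncomputable abbrev augmentationIdeal : Submodule (FreeAlgebra F I) (FreeAlgebra F I) :=
  LinearMap.ker (augmentationLinear F I)

variable {F I}

lemma mem_augmentationIdeal_iff (a : FreeAlgebra F I) :
    a ∈ augmentationIdeal F I ↔ augmentation F I a = 0 := Iff.rfl

lemma augmentation_ι (i : I) : augmentation F I (FreeAlgebra.ι F i) = 0 :=
  FreeAlgebra.lift_ι_apply _ _

/-- A free generator, as an element of the augmentation ideal. -/
noncomputable def augmentationIdealGenerator (i : I) : augmentationIdeal F I :=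
  ⟨FreeAlgebra.ι F i, augmentation_ι (F := F) i⟩

/-- The free generators generate the augmentation ideal, as a left ideal. -/
lemma sub_augmentation_mem_span (a : FreeAlgebra F I) :
    a - algebraMap F _ (augmentation F I a) ∈
      Submodule.span (FreeAlgebra F I) (Set.range (FreeAlgebra.ι F (X := I))) := by
  induction a using FreeAlgebra.induction with
  | grade0 c => simp
  | grade1 i =>
    rw [augmentation_ι, map_zero, sub_zero]
    exact Submodule.subset_span ⟨i, rfl⟩
  | mul a b ha hb =>
    have : a * b - algebraMap F _ (augmentation F I (a * b)) =
        a • (b - algebraMap F _ (augmentation F I b)) +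
        algebraMap F (FreeAlgebra F I) (augmentation F I b) •
          (a - algebraMap F _ (augmentation F I a)) := by
      have h := Algebra.commutes (augmentation F I b) a
      simp only [smul_eq_mul, map_mul, mul_sub]
      have h' : algebraMap F (FreeAlgebra F I) (augmentation F I a) *
          algebraMap F (FreeAlgebra F I) (augmentation F I b) =
          algebraMap F (FreeAlgebra F I) (augmentation F I b) *
            algebraMap F (FreeAlgebra F I) (augmentation F I a) := by
        rw [← map_mul, mul_comm, map_mul]
      rw [h, h']
      abel
    rw [this]
    exact add_mem (Submodule.smul_mem _ _ hb) (Submodule.smul_mem _ _ ha)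
  | add a b ha hb =>
    have := add_mem ha hb
    rwa [sub_add_sub_comm, ← map_add, ← map_add] at this

lemma span_augmentationIdealGenerator :
    Submodule.span (FreeAlgebra F I)
      (Set.range (augmentationIdealGenerator (F := F) (I := I))) = ⊤ := by
  rw [eq_top_iff]
  rintro ⟨a, ha⟩ -
  have h := sub_augmentation_mem_span a
  rw [(mem_augmentationIdeal_iff a).1 ha, map_zero, sub_zero] at h
  suffices ∀ b ∈ Submodule.span (FreeAlgebra F I) (Set.range (FreeAlgebra.ι F (X := I))),
      ∃ (hb : b ∈ augmentationIdeal F I), ⟨b, hb⟩ ∈ Submodule.span (FreeAlgebra F I)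
        (Set.range (augmentationIdealGenerator (F := F) (I := I))) from (this a h).2
  intro b hb
  induction hb using Submodule.span_induction with
  | mem b hb =>
    obtain ⟨i, rfl⟩ := hb
    exact ⟨augmentation_ι (F := F) i, Submodule.subset_span ⟨i, rfl⟩⟩
  | zero => exact ⟨zero_mem _, zero_mem _⟩
  | add b c _ _ hb hc =>
    obtain ⟨hb, hb'⟩ := hb
    obtain ⟨hc, hc'⟩ := hc
    exact ⟨add_mem hb hc, add_mem hb' hc'⟩
  | smul x b _ hb =>
    obtain ⟨hb, hb'⟩ := hb
    exact ⟨Submodule.smul_mem _ x hb, Submodule.smul_mem _ x hb'⟩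

/-- The derivation `F⟨I⟩ → F` (for the augmentation on both sides) with prescribed values on the
free generators: it is the second component of the algebra morphism to the dual numbers which sends
the generator `i` to `c i • ε`. -/
noncomputable def augmentationDerivation (c : I → F) : FreeAlgebra F I →ₗ[F] F :=
  TrivSqZeroExt.sndHom F F ∘ₗ
    (FreeAlgebra.lift F (fun i ↦ (TrivSqZeroExt.inr (c i) : TrivSqZeroExt F F))).toLinearMap

lemma augmentationDerivation_ι (c : I → F) (i : I) :
    augmentationDerivation c (FreeAlgebra.ι F i) = c i := by
  simp [augmentationDerivation]

lemma fst_lift_inr (c : I → F) (a : FreeAlgebra F I) :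
    (FreeAlgebra.lift F (fun i ↦ (TrivSqZeroExt.inr (c i) : TrivSqZeroExt F F)) a).fst =
      augmentation F I a := by
  have : (TrivSqZeroExt.fstHom F F F).comp
      (FreeAlgebra.lift F (fun i ↦ (TrivSqZeroExt.inr (c i) : TrivSqZeroExt F F))) =
        augmentation F I := by
    ext i
    simp [augmentation_ι]
  exact DFunLike.congr_fun this a

lemma augmentationDerivation_mul (c : I → F) (a b : FreeAlgebra F I) :
    augmentationDerivation c (a * b) = augmentation F I a * augmentationDerivation c b +
      augmentationDerivation c a * augmentation F I b := by
  rw [← fst_lift_inr c, ← fst_lift_inr c]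
  refine (congr_arg TrivSqZeroExt.snd (map_mul (FreeAlgebra.lift F
    (fun i ↦ (TrivSqZeroExt.inr (c i) : TrivSqZeroExt F F))) a b)).trans ?_
  rw [TrivSqZeroExt.snd_mul, smul_eq_mul, op_smul_eq_mul]
  rfl

/-- The morphism from the augmentation ideal to the trivial module with prescribed values on the
generators. -/
noncomputable def augmentationIdealLift (c : I → F) :
    augmentationIdeal F I →ₗ[FreeAlgebra F I] TrivialModule F where
  toFun a := augmentationDerivation c a.1
  map_add' a b := map_add (augmentationDerivation c) a.1 b.1
  map_smul' a b := by
    refine (augmentationDerivation_mul c a b.1).trans ?_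
    rw [(mem_augmentationIdeal_iff _).1 b.2, mul_zero, add_zero]
    rfl

variable (F I) in
/-- The short exact sequence `0 → K → F⟨I⟩ → F → 0`, where `K` is the augmentation ideal. -/
noncomputable def augmentationSequence : ShortComplex (ModuleCat.{w} (FreeAlgebra F I)) :=
  ShortComplex.mk (ModuleCat.ofHom (augmentationIdeal F I).subtype)
    (ModuleCat.ofHom (augmentationLinear F I)) (by
      ext x
      exact x.2)

lemma augmentationSequence_shortExact : (augmentationSequence F I).ShortExact where
  exact := by
    rw [ShortComplex.moduleCat_exact_iff]
    intro x hx
    exact ⟨⟨x, hx⟩, rfl⟩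
  mono_f := (ModuleCat.mono_iff_injective _).2 (Submodule.injective_subtype _)
  epi_g := (ModuleCat.epi_iff_surjective _).2 (fun c ↦ ⟨algebraMap F (FreeAlgebra F I) c,
    (augmentation F I).commutes c⟩)

instance : Projective (augmentationSequence F I).X₂ :=
  ModuleCat.projective_of_free (Module.Basis.singleton Unit (FreeAlgebra F I))

lemma subtype_comp_eq_zero (f : ModuleCat.of (FreeAlgebra F I) (FreeAlgebra F I) ⟶
    ModuleCat.of (FreeAlgebra F I) (TrivialModule F)) :
    (augmentationSequence F I).f ≫ f = 0 := by
  ext ⟨a, ha⟩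
  have h : f.hom a = a • f.hom 1 := by rw [← map_smul, smul_eq_mul, mul_one]
  refine h.trans ((trivialModule_smul a _).trans ?_)
  rw [(mem_augmentationIdeal_iff a).1 ha, zero_smul]
  rfl

open scoped ModuleCat.Algebra

/-- A morphism from the augmentation ideal to the trivial module is determined by its values on the
free generators, which are arbitrary. -/
noncomputable def homAugmentationIdealEquiv :
    ((augmentationSequence F I).X₁ ⟶ (augmentationSequence F I).X₃) ≃ₗ[F] (I → F) :=
  LinearEquiv.ofBijective
    { toFun := fun f i ↦ f.hom (augmentationIdealGenerator i)
      map_add' := fun f g ↦ rfl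
      map_smul' := fun c f ↦ by
        ext i
        have h (x : TrivialModule F) : algebraMap F (FreeAlgebra F I) c • x = c • x := by
          rw [trivialModule_smul, AlgHom.commutes]
          rfl
        exact h (f.hom (augmentationIdealGenerator i)) } ⟨by
    intro f g h
    apply ModuleCat.hom_ext
    apply LinearMap.ext_on_range span_augmentationIdealGenerator
    exact fun i ↦ congr_fun h i, fun c ↦ ⟨ModuleCat.ofHom (augmentationIdealLift c), by
      ext i
      exact augmentationDerivation_ι c i⟩⟩

variable (F I) in
/-- `Ext¹(F, F) ≃ F ^ I` over the free algebra `F⟨I⟩`. -/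
noncomputable def extOneTrivialModuleEquiv :
    Ext (ModuleCat.of (FreeAlgebra F I) (TrivialModule F))
      (ModuleCat.of (FreeAlgebra F I) (TrivialModule F)) 1 ≃ₗ[F] (I → F) :=
  ((augmentationSequence_shortExact (F := F) (I := I)).homEquivExtOne F
    subtype_comp_eq_zero).symm.trans
    homAugmentationIdealEquiv

end FirstExt

/-! ### Triangulated functors and morphisms of degree one between objects of hearts -/

/-- In a distinguished triangle, the middle object may be replaced by an isomorphic object. -/
lemma CategoryTheory.Pretriangulated.distinguished_of_iso₂ {E : Type*} [Category* E]
    [HasZeroObject E] [HasShift E ℤ] [Preadditive E] [∀ n : ℤ, (shiftFunctor E n).Additive]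
    [Pretriangulated E] {X Y Z Y' : E} {a : X ⟶ Y} {b : Y ⟶ Z} {c : Z ⟶ X⟦(1 : ℤ)⟧}
    (hT : Triangle.mk a b c ∈ distTriang E) (u : Y ≅ Y') {a' : X ⟶ Y'} {b' : Y' ⟶ Z}
    (ha : a' = a ≫ u.hom) (hb : b' = u.inv ≫ b) : Triangle.mk a' b' c ∈ distTriang E :=
  isomorphic_distinguished _ hT _ (Triangle.isoMk _ _ (Iso.refl _) u.symm (Iso.refl _)
    (by
      refine (congr_arg (· ≫ u.inv) ha).trans ?_
      exact ((Category.assoc _ _ _).trans (by rw [u.hom_inv_id, Category.comp_id])).trans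
        (Category.id_comp a).symm)
    ((Category.comp_id b').trans hb)
    (by
      refine (congr_arg (c ≫ ·) ((shiftFunctor E (1 : ℤ)).map_id X)).trans ?_
      exact (Category.comp_id c).trans (Category.id_comp c).symm))

namespace CategoryTheory.Triangulated

open Pretriangulated

variable {C B D E : Type*} [Category* C] [Category* B] [Category* D] [Category* E]
  [HasZeroObject D] [HasShift D ℤ] [Preadditive D] [∀ n : ℤ, (shiftFunctor D n).Additive]
  [Pretriangulated D]
  [HasZeroObject E] [HasShift E ℤ] [Preadditive E] [∀ n : ℤ, (shiftFunctor E n).Additive]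
  [Pretriangulated E]
  (G : D ⥤ E) [G.CommShift ℤ]
  {s : C ⥤ D} {S : B ⥤ E} {ι : C ⥤ B}
  (θ : ∀ X, G.obj (s.obj X) ≅ S.obj (ι.obj X))

/-- The map from `Hom(s X, (s Y)⟦1⟧)` to `Hom(S (ι X), (S (ι Y))⟦1⟧)` induced by a functor `G`
which commutes with the shift and identifies `s` with `ι ⋙ S`. -/
def mapHomShift [G.Additive] (X Y : C) :
    (s.obj X ⟶ (s.obj Y)⟦(1 : ℤ)⟧) →+ (S.obj (ι.obj X) ⟶ (S.obj (ι.obj Y))⟦(1 : ℤ)⟧) where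
  toFun φ := (θ X).inv ≫ G.map φ ≫ (G.commShiftIso (1 : ℤ)).hom.app _ ≫ (θ Y).hom⟦(1 : ℤ)⟧'
  map_zero' := by
    simp
  map_add' φ ψ := by
    simp

variable [G.IsTriangulated] [G.ReflectsIsomorphisms] (t : TStructure E)
  [∀ X, t.IsGE (S.obj X) 0] [∀ X, t.IsLE (S.obj X) 0]
  (hθ : ∀ {X Y : C} (f : X ⟶ Y), G.map (s.map f) ≫ (θ Y).hom = (θ X).hom ≫ S.map (ι.map f))

include t hθ

/-- The middle object of the distinguished triangle on `φ` is isomorphic to some `s.obj M`. If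
`G.map φ = 0`, then the image of this triangle by `G` splits, and since `S` and `ι` are full, the
splitting comes from a morphism `X ⟶ M`, up to an isomorphism. Hence the triangle splits. -/
lemma eq_zero_of_map_eq_zero [S.Full] [ι.Full]
    (hs : ∀ A : D, t.IsGE (G.obj A) 0 → t.IsLE (G.obj A) 0 → ∃ M, Nonempty (A ≅ s.obj M))
    {X Y : C} (φ : s.obj X ⟶ (s.obj Y)⟦(1 : ℤ)⟧) (hφ : G.map φ = 0) : φ = 0 := by
  obtain ⟨A, a, p, hT⟩ := distinguished_cocone_triangle₂ φ
  have hGT := G.map_distinguished _ hT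
  have hGE (Z : C) : t.IsGE (G.obj (s.obj Z)) 0 := t.isGE_of_iso (θ Z).symm 0
  have hLE (Z : C) : t.IsLE (G.obj (s.obj Z)) 0 := t.isLE_of_iso (θ Z).symm 0
  obtain ⟨M, ⟨u⟩⟩ := hs A (t.isGE₂ _ hGT 0 (hGE Y) (hGE X)) (t.isLE₂ _ hGT 0 (hLE Y) (hLE X))
  obtain ⟨σ₀, hσ₀⟩ : ∃ σ₀ : G.obj (s.obj X) ⟶ G.obj A, 𝟙 _ = σ₀ ≫ G.map p :=
    Triangle.coyoneda_exact₃ _ hGT (𝟙 (G.obj (s.obj X))) (by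
      refine (Category.id_comp _).trans ?_
      exact (congr_arg (· ≫ (G.commShiftIso (1 : ℤ)).hom.app (s.obj Y)) hφ).trans zero_comp)
  obtain ⟨σ₁, hσ₁⟩ := S.map_surjective ((θ X).inv ≫ σ₀ ≫ G.map u.hom ≫ (θ M).hom)
  obtain ⟨σ, rfl⟩ := ι.map_surjective σ₁
  have hσ : G.map (s.map σ) = σ₀ ≫ G.map u.hom := by
    rw [← cancel_mono (θ M).hom, hθ, hσ₁]
    simp
  -- `s.map σ ≫ u.inv` is a section of `p` after applying `G`, hence a section up to isomorphism
  have h₁ : G.map ((s.map σ ≫ u.inv) ≫ p) = 𝟙 _ := by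
    rw [hσ₀, G.map_comp, G.map_comp, hσ]
    simp
  have : IsIso (G.map ((s.map σ ≫ u.inv) ≫ p)) := by rw [h₁]; infer_instance
  have := isIso_of_reflects_iso ((s.map σ ≫ u.inv) ≫ p) G
  have h₂ : p ≫ φ = 0 := comp_distTriang_mor_zero₂₃ _ hT
  rw [← cancel_epi ((s.map σ ≫ u.inv) ≫ p), comp_zero, Category.assoc, h₂, comp_zero]

lemma mapHomShift_injective [G.Additive] [S.Full] [ι.Full]
    (hs : ∀ A : D, t.IsGE (G.obj A) 0 → t.IsLE (G.obj A) 0 → ∃ M, Nonempty (A ≅ s.obj M))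
    (X Y : C) : Function.Injective (mapHomShift G θ X Y) := by
  rw [injective_iff_map_eq_zero]
  intro φ hφ
  refine eq_zero_of_map_eq_zero G θ t hθ hs φ ?_
  have h : (θ X).inv ≫ G.map φ ≫ (G.commShiftIso (1 : ℤ)).hom.app _ ≫
    (θ Y).hom⟦(1 : ℤ)⟧' = 0 := hφ
  have h' : IsIso ((G.commShiftIso (1 : ℤ)).hom.app (s.obj Y) ≫ (θ Y).hom⟦(1 : ℤ)⟧') :=
    inferInstance
  rw [← cancel_epi (θ X).inv, comp_zero]
  refine (cancel_mono ((G.commShiftIso (1 : ℤ)).hom.app (s.obj Y) ≫ (θ Y).hom⟦(1 : ℤ)⟧')).1 ?_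
  rw [zero_comp, Category.assoc]
  exact h

/-- A morphism of degree one which completes the image of a complex `Y ⟶ M ⟶ X` to a distinguished
triangle is in the image of `mapHomShift`: the comparison morphism from the cone of
`s.map i` to `s.obj X` is an isomorphism because it becomes one after applying `G`. -/
lemma exists_mapHomShift_eq [G.Additive] [Preadditive C] [s.Additive] {X Y M : C} {i : Y ⟶ M} {p : M ⟶ X} (w : i ≫ p = 0)
    (e : S.obj (ι.obj X) ⟶ (S.obj (ι.obj Y))⟦(1 : ℤ)⟧)
    (hT : Triangle.mk (S.map (ι.map i)) (S.map (ι.map p)) e ∈ distTriang E) :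
    ∃ φ, mapHomShift G θ X Y φ = e := by
  obtain ⟨W, c, δ, hW⟩ := distinguished_cocone_triangle (s.map i)
  obtain ⟨q, hq⟩ : ∃ q : W ⟶ s.obj X, s.map p = c ≫ q :=
    Triangle.yoneda_exact₂ _ hW (s.map p) (by
      change s.map i ≫ s.map p = 0
      rw [← s.map_comp, w, s.map_zero])
  have hGW := G.map_distinguished _ hW
  obtain ⟨k, hk₁, hk₂⟩ : ∃ k : G.obj W ⟶ S.obj (ι.obj X),
      G.map c ≫ k = (θ M).hom ≫ S.map (ι.map p) ∧
        (G.map δ ≫ (G.commShiftIso (1 : ℤ)).hom.app _) ≫ (θ Y).hom⟦(1 : ℤ)⟧' = k ≫ e :=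
    complete_distinguished_triangle_morphism _ _ hGW hT (θ Y).hom (θ M).hom (hθ i)
  let κ : G.mapTriangle.obj (Triangle.mk (s.map i) c δ) ⟶
      Triangle.mk (S.map (ι.map i)) (S.map (ι.map p)) e :=
    { hom₁ := (θ Y).hom, hom₂ := (θ M).hom, hom₃ := k
      comm₁ := hθ i, comm₂ := hk₁, comm₃ := hk₂ }
  have hk : IsIso k := isIso₃_of_isIso₁₂ κ hGW hT (inferInstanceAs (IsIso (θ Y).hom))
    (inferInstanceAs (IsIso (θ M).hom))
  -- `G.map q` and `k` differ by a morphism which factors through `(G.obj (s.obj Y))⟦1⟧`, and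
  -- there are no non-zero morphisms from this object to the heart
  have hqk : G.map q ≫ (θ X).hom = k := by
    rw [← sub_eq_zero]
    obtain ⟨z, hz⟩ : ∃ z : (G.obj (s.obj Y))⟦(1 : ℤ)⟧ ⟶ S.obj (ι.obj X),
        G.map q ≫ (θ X).hom - k = (G.map δ ≫ (G.commShiftIso (1 : ℤ)).hom.app _) ≫ z :=
      Triangle.yoneda_exact₃ _ hGW _ (by
        change G.map c ≫ (G.map q ≫ (θ X).hom - k) = 0
        rw [comp_sub, hk₁, ← hθ, hq, G.map_comp, Category.assoc, sub_self])
    have : t.IsLE (G.obj (s.obj Y)) 0 := t.isLE_of_iso (θ Y).symm 0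
    have := t.isLE_shift (G.obj (s.obj Y)) 0 1 (-1)
    rw [hz, t.zero z (-1) 0, comp_zero]
  have : IsIso (G.map q) := by
    have : IsIso (G.map q ≫ (θ X).hom) := by rwa [hqk]
    exact IsIso.of_isIso_comp_right _ (θ X).hom
  have := isIso_of_reflects_iso q G
  refine ⟨inv q ≫ δ, ?_⟩
  change (θ X).inv ≫ G.map (inv q ≫ δ) ≫ (G.commShiftIso (1 : ℤ)).hom.app _ ≫
    (θ Y).hom⟦(1 : ℤ)⟧' = e
  rw [Category.assoc] at hk₂
  rw [G.map_comp, Category.assoc, hk₂, ← hqk, Functor.map_inv]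
  simp

end CategoryTheory.Triangulated

/-! ### The functor from `D^b(C)` to `D(B)` induced by an exact functor `C ⥤ B` -/

section BoundedDerived

open Pretriangulated

variable {C B : Type*} [Category* C] [Category* B] [Abelian C] [Abelian B]

lemma CategoryTheory.Functor.exactAt_mapHomologicalComplex_iff (ι : C ⥤ B) [ι.Additive]
    [PreservesFiniteLimits ι] [PreservesFiniteColimits ι] [ι.Faithful]
    (K : CochainComplex C ℤ) (n : ℤ) :
    ((ι.mapHomologicalComplex (.up ℤ)).obj K).ExactAt n ↔ K.ExactAt n :=
  ShortComplex.exact_map_iff_of_faithful (K.sc n) ι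

lemma DerivedCategory.isZero_Q_obj_iff [HasDerivedCategory B] (L : CochainComplex B ℤ) :
    IsZero (DerivedCategory.Q.obj L) ↔ L.Acyclic := by
  have e (n : ℤ) : (homologyFunctor B n).obj (Q.obj L) ≅ L.homology n :=
    (homologyFunctorFactors B n).app L
  constructor
  · intro h n
    rw [HomologicalComplex.exactAt_iff_isZero_homology]
    exact ((homologyFunctor B n).map_isZero h).of_iso (e n).symm
  · intro h
    have h' (n : ℤ) : IsZero ((homologyFunctor B n).obj (Q.obj L)) :=
      ((HomologicalComplex.exactAt_iff_isZero_homology _ _).1 (h n)).of_iso (e n)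
    have : (Q.obj L).IsLE 0 := by
      rw [isLE_iff]
      exact fun n _ ↦ h' n
    have : (Q.obj L).IsGE 1 := by
      rw [isGE_iff]
      exact fun n _ ↦ h' n
    exact TStructure.t.isZero _ 0 1

/-- If a short complex gives rise to a distinguished triangle of complexes concentrated in degree
`0`, then it is short exact. -/
lemma DerivedCategory.shortExact_of_distinguished [HasDerivedCategory B] {S : ShortComplex B}
    (e : (singleFunctor B 0).obj S.X₃ ⟶ ((singleFunctor B 0).obj S.X₁)⟦(1 : ℤ)⟧)
    (hT : Triangle.mk ((singleFunctor B 0).map S.f) ((singleFunctor B 0).map S.g) e ∈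
      distTriang (DerivedCategory B)) : S.ShortExact := by
  have h₂ := HomologySequence.exact₂ _ hT 0
  have hf := (HomologySequence.mono_homologyMap_mor₁_iff _ hT (-1) 0).2
    ((isZero_of_isGE ((singleFunctor B 0).obj S.X₃) 0 (-1) (by lia)).eq_of_src _ _)
  have hg := (HomologySequence.epi_homologyMap_mor₂_iff _ hT 0 1).2
    ((isZero_of_isLE ((singleFunctor B 0).obj S.X₁) 0 1 (by lia)).eq_of_tgt _ _)
  have h : (S.map (singleFunctor B 0 ⋙ homologyFunctor B 0)).ShortExact :=
    { exact := h₂, mono_f := hf, epi_g := hg }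
  exact ShortComplex.shortExact_of_iso
    (S.mapNatIso (singleFunctorCompHomologyFunctorIso B 0)) h

variable (C) in
/-- The functor which sends an object to the bounded complex concentrated in degree `0`. -/
noncomputable def singleBounded : C ⥤ BoundedHomotopyCategory C :=
  (boundedComplexes C).lift (HomologicalComplex.single C (.up ℤ) 0 ⋙ HomotopyCategory.quotient _ _)
    (fun X ↦ (complexInDegreeZero X).2)

instance : (singleBounded C).Additive where
  map_add {X Y f g} := by
    apply (boundedComplexes C).ι.map_injective
    exact (HomologicalComplex.single C (.up ℤ) 0 ⋙ HomotopyCategory.quotient _ _).map_add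

/-- Quasi-isomorphisms between bounded complexes have an acyclic cone, and this cone is bounded. -/
lemma trW_boundedAcyclic_of_quasiIso {K L : CochainComplex C ℤ} (f : K ⟶ L) [QuasiIso f]
    (hK : boundedComplexes C ((HomotopyCategory.quotient _ _).obj K))
    (hL : boundedComplexes C ((HomotopyCategory.quotient _ _).obj L)) :
    (boundedAcyclic C).trW (X := ⟨_, hK⟩) (Y := ⟨_, hL⟩)
      ((boundedComplexes C).homMk ((HomotopyCategory.quotient _ _).map f)) := by
  obtain ⟨Z, g, h, hT⟩ := distinguished_cocone_triangle
    ((boundedComplexes C).homMk (X := ⟨_, hK⟩) (Y := ⟨_, hL⟩)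
      ((HomotopyCategory.quotient C (.up ℤ)).map f))
  refine ((boundedAcyclic C).trW_iff_of_distinguished _ hT).2 ?_
  have := (HomotopyCategory.subcategoryAcyclic C).trW_iff_of_distinguished _
    ((boundedComplexes C).ι.map_distinguished _ hT)
  refine this.1 ?_
  rw [← HomotopyCategory.quasiIso_eq_trW_subcategoryAcyclic]
  exact (HomotopyCategory.quotient_map_mem_quasiIso_iff f).2 ‹QuasiIso f›

variable (ι : C ⥤ B) [ι.Additive] [PreservesFiniteLimits ι] [PreservesFiniteColimits ι]
  [ι.Faithful] [HasDerivedCategory B]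

/-- The functor `K^b(C) ⥤ D(B)` induced by a functor `C ⥤ B`. -/
noncomputable abbrev boundedToDerived : BoundedHomotopyCategory C ⥤ DerivedCategory B :=
  (boundedComplexes C).ι ⋙ ι.mapHomotopyCategory (.up ℤ) ⋙ DerivedCategory.Qh

lemma isZero_boundedToDerived_obj_iff (K : BoundedHomotopyCategory C) :
    IsZero ((boundedToDerived ι).obj K) ↔ boundedAcyclic C K := by
  let K' : CochainComplex C ℤ := K.obj.as
  have h₁ : IsZero ((boundedToDerived ι).obj K) ↔
      ((ι.mapHomologicalComplex (.up ℤ)).obj K').Acyclic := by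
    refine (((DerivedCategory.quotientCompQhIso B).app
      ((ι.mapHomologicalComplex (.up ℤ)).obj K')).isZero_iff).trans ?_
    exact DerivedCategory.isZero_Q_obj_iff _
  have h₂ : boundedAcyclic C K ↔ K'.Acyclic :=
    HomotopyCategory.quotient_obj_mem_subcategoryAcyclic_iff_acyclic K'
  rw [h₁, h₂]
  exact forall_congr' (fun n ↦ ι.exactAt_mapHomologicalComplex_iff K' n)

lemma boundedToDerived_isInvertedBy : (boundedAcyclic C).trW.IsInvertedBy (boundedToDerived ι) := by
  intro X Y s hs
  obtain ⟨Z, g, h, hT, hZ⟩ := (boundedAcyclic C).trW_iff s |>.1 hs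
  exact (Triangle.isZero₃_iff_isIso₁ _ ((boundedToDerived ι).map_distinguished _ hT)).1
    ((isZero_boundedToDerived_obj_iff ι Z).2 hZ)

/-- The triangulated functor `D^b(C) ⥤ D(B)` induced by an exact functor `C ⥤ B`. -/
noncomputable def boundedDerivedToDerived : BoundedDerivedCategory C ⥤ DerivedCategory B :=
  Localization.lift (boundedToDerived ι) (boundedToDerived_isInvertedBy ι) (boundedAcyclic C).trW.Q

noncomputable instance : Localization.Lifting (boundedAcyclic C).trW.Q (boundedAcyclic C).trW
    (boundedToDerived ι) (boundedDerivedToDerived ι) :=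
  inferInstanceAs (Localization.Lifting _ _ _ (Localization.lift _ _ _))

noncomputable instance : (boundedDerivedToDerived ι).CommShift ℤ :=
  Functor.commShiftOfLocalization (boundedAcyclic C).trW.Q (boundedAcyclic C).trW ℤ
    (boundedToDerived ι) (boundedDerivedToDerived ι)

/-- The functor `D^b(C) ⥤ D(B)` is induced by `K^b(C) ⥤ D(B)`. -/
noncomputable def QCompBoundedDerivedToDerived :
    (boundedAcyclic C).trW.Q ⋙ boundedDerivedToDerived ι ≅ boundedToDerived ι :=
  Localization.Lifting.iso _ (boundedAcyclic C).trW _ _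

instance : NatTrans.CommShift (QCompBoundedDerivedToDerived ι).hom ℤ :=
  inferInstanceAs (NatTrans.CommShift (Localization.Lifting.iso
    (boundedAcyclic C).trW.Q (boundedAcyclic C).trW
    (boundedToDerived ι) (boundedDerivedToDerived ι)).hom ℤ)

instance : (boundedAcyclic C).trW.Q.mapArrow.EssSurj :=
  Localization.essSurj_mapArrow _ (boundedAcyclic C).trW

instance : (boundedDerivedToDerived ι).IsTriangulated :=
  Functor.isTriangulated_of_precomp_iso (QCompBoundedDerivedToDerived ι)

instance : (boundedDerivedToDerived ι).Additive := by
  rw [Localization.functor_additive_iff (boundedAcyclic C).trW.Q (boundedAcyclic C).trW]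
  exact Functor.additive_of_iso (QCompBoundedDerivedToDerived ι).symm

/-- As `ι` is exact and faithful, a complex which becomes acyclic over `B` is acyclic, so that
`D^b(C) ⥤ D(B)` is conservative. -/
instance : (boundedDerivedToDerived ι).ReflectsIsomorphisms where
  reflects {X Y} f hf := by
    obtain ⟨Z, g, h, hT⟩ := distinguished_cocone_triangle f
    have hZ : IsZero ((boundedDerivedToDerived ι).obj Z) :=
      (Triangle.isZero₃_iff_isIso₁ _ ((boundedDerivedToDerived ι).map_distinguished _ hT)).2 hf
    refine (Triangle.isZero₃_iff_isIso₁ _ hT).1 (IsZero.of_iso ?_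
      ((boundedAcyclic C).trW.Q.objObjPreimageIso Z).symm)
    exact isZero_Q_obj _ ((isZero_boundedToDerived_obj_iff ι _).1 <| hZ.of_iso (((QCompBoundedDerivedToDerived ι).app _).symm ≪≫
      (boundedDerivedToDerived ι).mapIso ((boundedAcyclic C).trW.Q.objObjPreimageIso Z)))

variable (C) in
/-- The functor which sends an object to the complex concentrated in degree `0`. -/
noncomputable abbrev singleBoundedDerived : C ⥤ BoundedDerivedCategory C :=
  singleBounded C ⋙ (boundedAcyclic C).trW.Q

/-- Compatibility of `D^b(C) ⥤ D(B)` with the embeddings of `C` and `B`. -/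
noncomputable def singleBoundedDerivedCompIso :
    singleBoundedDerived C ⋙ boundedDerivedToDerived ι ≅ ι ⋙ DerivedCategory.singleFunctor B 0 :=
  Functor.associator _ _ _ ≪≫
    Functor.isoWhiskerLeft (singleBounded C) (QCompBoundedDerivedToDerived ι) ≪≫
    Functor.isoWhiskerLeft (HomologicalComplex.single C (.up ℤ) 0)
      (Functor.isoWhiskerRight (ι.mapHomotopyCategoryFactors (.up ℤ)) DerivedCategory.Qh) ≪≫
    Functor.isoWhiskerRight (HomologicalComplex.singleMapHomologicalComplex ι (.up ℤ) 0)
      (HomotopyCategory.quotient _ _ ⋙ DerivedCategory.Qh)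

lemma nonempty_iso_of_quasiIso {K L : CochainComplex C ℤ} (f : K ⟶ L) [QuasiIso f]
    (hK : boundedComplexes C ((HomotopyCategory.quotient _ _).obj K))
    (hL : boundedComplexes C ((HomotopyCategory.quotient _ _).obj L)) :
    Nonempty ((boundedAcyclic C).trW.Q.obj ⟨_, hK⟩ ≅ (boundedAcyclic C).trW.Q.obj ⟨_, hL⟩) :=
  ⟨Localization.isoOfHom _ (boundedAcyclic C).trW _ (trW_boundedAcyclic_of_quasiIso f hK hL)⟩

open DerivedCategory in
/-- An object of `D^b(C)` whose image in `D(B)` is concentrated in degree `0` is isomorphic to an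
object of `C`. -/
lemma exists_iso_singleBoundedDerived_obj (A : BoundedDerivedCategory C)
    (h₁ : ((boundedDerivedToDerived ι).obj A).IsGE 0)
    (h₂ : ((boundedDerivedToDerived ι).obj A).IsLE 0) :
    ∃ M, Nonempty (A ≅ (singleBoundedDerived C).obj M) := by
  obtain ⟨⟨⟨K⟩, a, b, hKa, hKb⟩, ⟨e⟩⟩ : ∃ K, Nonempty ((boundedAcyclic C).trW.Q.obj K ≅ A) :=
    ⟨_, ⟨(boundedAcyclic C).trW.Q.objObjPreimageIso A⟩⟩
  let K : CochainComplex C ℤ := K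
  have hK : boundedComplexes C ((HomotopyCategory.quotient _ _).obj K) := ⟨a, b, hKa, hKb⟩
  have e' : (boundedDerivedToDerived ι).obj A ≅ Q.obj ((ι.mapHomologicalComplex (.up ℤ)).obj K) :=
    (boundedDerivedToDerived ι).mapIso e.symm ≪≫ (QCompBoundedDerivedToDerived ι).app _ ≪≫
      (quotientCompQhIso B).app ((ι.mapHomologicalComplex (.up ℤ)).obj K)
  have : K.IsGE 0 := by
    have := (isGE_Q_obj_iff _ 0).1 (TStructure.t.isGE_of_iso e' 0)
    rw [CochainComplex.isGE_iff] at this ⊢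
    exact fun i hi ↦ (ι.exactAt_mapHomologicalComplex_iff K i).1 (this i hi)
  have : K.IsLE 0 := by
    have := (isLE_Q_obj_iff _ 0).1 (TStructure.t.isLE_of_iso e' 0)
    rw [CochainComplex.isLE_iff] at this ⊢
    exact fun i hi ↦ (ι.exactAt_mapHomologicalComplex_iff K i).1 (this i hi)
  -- `K` is connected to an object of `C` by the quasi-isomorphisms `τ≤0 K ⟶ K` and
  -- `τ≤0 K ⟶ τ≥0 τ≤0 K`, and these truncations are bounded
  have hKa' : (K.truncLE 0).IsStrictlyGE a := by
    have : K.IsStrictlyGE a := hKa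
    dsimp [CochainComplex.truncLE]
    infer_instance
  have : (K.truncLE 0).IsGE 0 := by
    have hK' : K.IsGE 0 := inferInstance
    rw [CochainComplex.isGE_iff] at hK' ⊢
    intro i hi
    exact (exactAt_iff_of_quasiIsoAt (K.ιTruncLE 0) i).2 (hK' i hi)
  obtain ⟨M, ⟨e''⟩⟩ := ((K.truncLE 0).truncGE 0).exists_iso_single 0
  have hK₁ : boundedComplexes C ((HomotopyCategory.quotient _ _).obj (K.truncLE 0)) :=
    ⟨a, 0, hKa', inferInstanceAs ((K.truncLE 0).IsStrictlyLE 0)⟩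
  have hK₂ : boundedComplexes C ((HomotopyCategory.quotient _ _).obj
      ((K.truncLE 0).truncGE 0)) :=
    ⟨0, 0, inferInstanceAs (((K.truncLE 0).truncGE 0).IsStrictlyGE 0),
      inferInstanceAs (((K.truncLE 0).truncGE 0).IsStrictlyLE 0)⟩
  obtain ⟨i₁⟩ := nonempty_iso_of_quasiIso (K.ιTruncLE 0) hK₁ hK
  obtain ⟨i₂⟩ := nonempty_iso_of_quasiIso ((K.truncLE 0).πTruncGE 0) hK₁ hK₂
  obtain ⟨i₃⟩ := nonempty_iso_of_quasiIso e''.hom hK₂ (complexInDegreeZero M).2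
  exact ⟨M, ⟨e.symm ≪≫ i₁.symm ≪≫ i₂ ≪≫ i₃⟩⟩

variable [ι.Full]

open DerivedCategory Triangulated in
/-- If extensions of `ι X` by `ι Y` belong to the essential image of the fully faithful exact
functor `ι : C ⥤ B`, then the map `Hom(X, Y⟦1⟧) → Hom(ι X, (ι Y)⟦1⟧)` is bijective. -/
lemma mapHomShift_boundedDerivedToDerived_bijective (X Y : C)
    (h : ∀ (M : B) (f : ι.obj Y ⟶ M) (g : M ⟶ ι.obj X) (w : f ≫ g = 0),
      (ShortComplex.mk f g w).ShortExact → ι.essImage M) :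
    Function.Bijective (mapHomShift (boundedDerivedToDerived ι) (s := singleBoundedDerived C)
      (S := singleFunctor B 0) (fun Z ↦ (singleBoundedDerivedCompIso ι).app Z) X Y) := by
  constructor
  · exact mapHomShift_injective (boundedDerivedToDerived ι) (s := singleBoundedDerived C)
      (S := singleFunctor B 0) (fun Z ↦ (singleBoundedDerivedCompIso ι).app Z) TStructure.t
      (fun f ↦ (singleBoundedDerivedCompIso ι).hom.naturality f)
      (exists_iso_singleBoundedDerived_obj ι) X Y
  · intro e
    obtain ⟨E, a, p, hT⟩ := distinguished_cocone_triangle₂ e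
    obtain ⟨M, ⟨u⟩⟩ : ∃ M, Nonempty (E ≅ (singleFunctor B 0).obj M) := by
      have : E.IsGE 0 :=
        TStructure.t.isGE₂ _ hT 0 (inferInstanceAs (((singleFunctor B 0).obj _).IsGE 0))
          (inferInstanceAs (((singleFunctor B 0).obj _).IsGE 0))
      have : E.IsLE 0 :=
        TStructure.t.isLE₂ _ hT 0 (inferInstanceAs (((singleFunctor B 0).obj _).IsLE 0))
          (inferInstanceAs (((singleFunctor B 0).obj _).IsLE 0))
      exact E.exists_iso_singleFunctor_obj_of_isGE_of_isLE 0
    -- `e` is the class of the extension `ι Y ⟶ M ⟶ ι X`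
    obtain ⟨f, hf⟩ := (singleFunctor B 0).map_surjective (a ≫ u.hom)
    obtain ⟨g, hg⟩ := (singleFunctor B 0).map_surjective (u.inv ≫ p)
    have hT' := distinguished_of_iso₂ hT u hf hg
    have hfg : f ≫ g = 0 := (singleFunctor B 0).map_injective (by
      rw [Functor.map_comp, Functor.map_zero]
      exact comp_distTriang_mor_zero₁₂ _ hT')
    obtain ⟨M', ⟨v⟩⟩ := h M f g hfg (shortExact_of_distinguished e hT')
    obtain ⟨i, hi⟩ := ι.map_surjective (f ≫ v.inv)
    obtain ⟨q, hq⟩ := ι.map_surjective (v.hom ≫ g)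
    refine exists_mapHomShift_eq (boundedDerivedToDerived ι) (s := singleBoundedDerived C)
      (S := singleFunctor B 0) (fun Z ↦ (singleBoundedDerivedCompIso ι).app Z) TStructure.t
      (fun f ↦ (singleBoundedDerivedCompIso ι).hom.naturality f) (i := i) (p := q)
      (ι.map_injective ?_) e ?_
    · rw [ι.map_comp, ι.map_zero, hi, hq, Category.assoc, v.inv_hom_id_assoc, hfg]
    · exact distinguished_of_iso₂ hT' ((singleFunctor B 0).mapIso v.symm)
        (by rw [hi, Functor.map_comp]; rfl) (by rw [hq, Functor.map_comp]; rfl)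

end BoundedDerived

/-! ### Morphisms of degree one in the bounded derived category of `ExtTriv F I` -/

section HomShift

variable (F : Type w) [Field F] (I : Type w)

variable {F I} in
/-- An extension of the trivial module by itself belongs to `ExtTriv F I`. -/
lemma isExtensionOfTrivial_of_shortExact {M : ModuleCat.{w} (FreeAlgebra F I)}
    (f : (trivialObject F I).obj ⟶ M) (g : M ⟶ (trivialObject F I).obj) (w : f ≫ g = 0)
    (hS : (ShortComplex.mk f g w).ShortExact) : isExtensionOfTrivial F I M := by
  have : IsNoetherian (FreeAlgebra F I) (trivialObject F I).obj :=
    inferInstanceAs (IsNoetherian (FreeAlgebra F I) (TrivialModule F))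
  have hsmul' (a : FreeAlgebra F I) (ha : augmentation F I a = 0) (x : TrivialModule F) :
      a • x = 0 := by rw [trivialModule_smul, ha, zero_smul]
  have hsmul (a : FreeAlgebra F I) (ha : augmentation F I a = 0) (x : (trivialObject F I).obj) :
      a • x = 0 := hsmul' a ha x
  have hex : Function.Exact f.hom g.hom :=
    (ShortComplex.ShortExact.moduleCat_exact_iff_function_exact _).1 hS.exact
  rw [isExtensionOfTrivial_iff]
  refine ⟨isNoetherian_of_range_eq_ker f.hom g.hom (LinearMap.exact_iff.1 hex).symm,
    fun a b ha hb m ↦ ?_⟩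
  obtain ⟨x, hx⟩ := (hex (b • m)).1 (by rw [map_smul, hsmul b hb])
  rw [← hx, ← map_smul, hsmul a ha, map_zero]

instance : PreservesFiniteLimits (isExtensionOfTrivial F I).ι :=
  have := (isExtensionOfTrivial F I).preservesKernels_ι
  Functor.preservesFiniteLimits_of_preservesKernels _

instance : PreservesFiniteColimits (isExtensionOfTrivial F I).ι :=
  have := (isExtensionOfTrivial F I).preservesCokernels_ι
  Functor.preservesFiniteColimits_of_preservesCokernels _

lemma nonempty_homShift_trivialObject_addEquiv :
    Nonempty ((inBoundedDerivedCategory (trivialObject F I) ⟶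
      (inBoundedDerivedCategory (trivialObject F I))⟦(1 : ℤ)⟧) ≃+ (I → F)) := by
  let := HasDerivedCategory.standard (ModuleCat.{w} (FreeAlgebra F I))
  have h := mapHomShift_boundedDerivedToDerived_bijective (isExtensionOfTrivial F I).ι
    (trivialObject F I) (trivialObject F I) (fun M f g w hS ↦
      ⟨⟨M, isExtensionOfTrivial_of_shortExact f g w hS⟩, ⟨Iso.refl _⟩⟩)
  exact ⟨(AddEquiv.ofBijective _ h).trans
    ((Abelian.Ext.homAddEquiv (n := 1)).symm.trans
      (extOneTrivialModuleEquiv F I).toAddEquiv)⟩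

end HomShift

/-! ### Categories with small Hom sets -/

section LocallySmall

variable {U : ZFSet.{w}}

namespace IsGrothendieckUniverse

variable (hU : IsGrothendieckUniverse U)
include hU

lemma isSmallIn_pi {α : Type*} {β : α → Type*} (hα : IsSmallIn U α)
    (hβ : ∀ a, IsSmallIn U (β a)) : IsSmallIn U (∀ a, β a) :=
  hU.isSmallIn_of_injective (hU.isSmallIn_fun hα (hU.isSmallIn_sigma hα hβ))
    (fun f a ↦ ⟨a, f a⟩) (fun f g h ↦ by
      ext a
      exact eq_of_heq (Sigma.mk.inj (congr_fun h a)).2)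

lemma isUniverseCategory_boundedHomotopyCategory (hω : ZFSet.omega ∈ U) {C : Type*} [Category* C]
    [Abelian C] (hC : IsUniverseCategory U C) :
    IsUniverseCategory U (BoundedHomotopyCategory C) := by
  intro K L
  let K' : CochainComplex C ℤ := K.obj.as
  let L' : CochainComplex C ℤ := L.obj.as
  have h : IsSmallIn U (K' ⟶ L') :=
    hU.isSmallIn_of_injective (hU.isSmallIn_pi (hU.isSmallIn_of_countable hω ℤ)
      (fun n ↦ hC (K'.X n) (L'.X n))) (fun f n ↦ f.f n) (fun f g hfg ↦ by
        ext n
        exact congr_fun hfg n)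
  exact hU.isSmallIn_of_surjective h
    (fun f ↦ (boundedComplexes C).homMk ((HomotopyCategory.quotient C (.up ℤ)).map f)) (fun g ↦ by
      obtain ⟨f, hf⟩ := (HomotopyCategory.quotient C (.up ℤ)).map_surjective (X := K') (Y := L')
        g.hom
      exact ⟨f, (boundedComplexes C).ι.map_injective hf⟩)

lemma isUniverseCategory_abelianisation {T : Type*} [Category* T] [Preadditive T]
    (hT : IsUniverseCategory U T) : IsUniverseCategory U (Abelianisation T) := by
  intro X Y
  obtain ⟨u, rfl⟩ := RightFreyd.exists_quotient_obj_eq X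
  obtain ⟨v, rfl⟩ := RightFreyd.exists_quotient_obj_eq Y
  have h : IsSmallIn U (u ⟶ v) :=
    hU.isSmallIn_of_injective (hU.isSmallIn_prod (hT u.left v.left) (hT u.right v.right))
      (fun f ↦ (f.left, f.right)) (fun f g hfg ↦
        Arrow.hom_ext _ _ (congr_arg Prod.fst hfg) (congr_arg Prod.snd hfg))
  exact hU.isSmallIn_of_surjective h _ (RightFreyd.quotient T).map_surjective

lemma isUniverseCategory_of_equivalence {C D : Type*} [Category* C] [Category* D] (e : C ≌ D)
    (hD : IsUniverseCategory U D) : IsUniverseCategory U C := fun _ _ ↦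
  hU.isSmallIn_of_injective (hD _ _) e.functor.map e.functor.map_injective

end IsGrothendieckUniverse

/-- A category is essentially small with respect to `U` if its objects are, up to isomorphism,
the members of a family indexed by an element of `U`. -/
def IsEssentiallySmallIn (U : ZFSet.{w}) (C : Type*) [Category* C] : Prop :=
  ∃ x ∈ U, ∃ c : {y // y ∈ x} → C, ∀ X : C, ∃ j, Nonempty (X ≅ c j)

lemma IsEssentiallySmallIn.exists_family {C : Type*} [Category* C]
    (h : IsEssentiallySmallIn U C) :
    ∃ (J : Type (w + 1)) (c : J → C), IsSmallIn U J ∧ ∀ X, ∃ j, Nonempty (X ≅ c j) := by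
  obtain ⟨x, hx, c, hc⟩ := h
  exact ⟨_, c, ⟨x, hx, ⟨Equiv.refl _⟩⟩, hc⟩

namespace IsGrothendieckUniverse

variable (hU : IsGrothendieckUniverse U)
include hU

/-- A category is essentially small with respect to `U` if its objects can be encoded, up to
isomorphism, by the elements of a set in `U`. -/
lemma isEssentiallySmallIn_of_code {C J : Type*} [Category* C] (hJ : IsSmallIn U J)
    (P : J → C → Prop) (hP : ∀ X, ∃ j, P j X)
    (hP' : ∀ j X Y, P j X → P j Y → Nonempty (X ≅ Y)) : IsEssentiallySmallIn U C := by
  obtain ⟨x, hx, ⟨e⟩⟩ := hU.isSmallIn_of_injective hJ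
    (Subtype.val : {j : J // ∃ X, P j X} → J) Subtype.val_injective
  refine ⟨x, hx, fun y ↦ (e.symm y).2.choose, fun X ↦ ?_⟩
  obtain ⟨j, hj⟩ := hP X
  refine ⟨e ⟨j, X, hj⟩, hP' j _ _ hj ?_⟩
  have h : (e.symm (e ⟨j, X, hj⟩)).1 = j := congr_arg Subtype.val (e.symm_apply_apply _)
  exact cast (congr_arg (P · _) h) (e.symm (e ⟨j, X, hj⟩)).2.choose_spec

lemma isEssentiallySmallIn_boundedHomotopyCategory (hω : ZFSet.omega ∈ U) {C : Type*}
    [Category* C] [Abelian C] (hC : IsUniverseCategory U C) (hC' : IsEssentiallySmallIn U C) :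
    IsEssentiallySmallIn U (BoundedHomotopyCategory C) := by
  obtain ⟨J, c, hJ, hc⟩ := hC'.exists_family
  have hℤ := hU.isSmallIn_of_countable hω ℤ
  -- a complex is encoded by its objects and its differentials
  refine hU.isEssentiallySmallIn_of_code
    (hU.isSmallIn_sigma (hU.isSmallIn_fun hℤ hJ)
      (fun o ↦ hU.isSmallIn_pi hℤ (fun n ↦ hC (c (o n)) (c (o (n + 1))))))
    (fun j K ↦ ∃ φ : ∀ n, K.obj.as.X n ≅ c (j.1 n),
      ∀ n, (φ n).inv ≫ K.obj.as.d n (n + 1) ≫ (φ (n + 1)).hom = j.2 n)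
    (fun K ↦ ?_) ?_
  · choose o φ using fun n ↦ hc (K.obj.as.X n)
    exact ⟨⟨o, fun n ↦ (φ n).some.inv ≫ K.obj.as.d n (n + 1) ≫ (φ (n + 1)).some.hom⟩,
      fun n ↦ (φ n).some, fun n ↦ rfl⟩
  · rintro ⟨o, d⟩ K L ⟨φ, hφ⟩ ⟨ψ, hψ⟩
    let K' : CochainComplex C ℤ := K.obj.as
    let L' : CochainComplex C ℤ := L.obj.as
    let α (n : ℤ) : K'.X n ≅ L'.X n := φ n ≪≫ (ψ n).symm
    let e : K' ≅ L' := HomologicalComplex.Hom.isoOfComponents α (by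
      rintro n _ rfl
      have h := (hφ n).trans (hψ n).symm
      have h' : K'.d n (n + 1) ≫ (φ (n + 1)).hom =
        (φ n).hom ≫ (ψ n).inv ≫ L'.d n (n + 1) ≫ (ψ (n + 1)).hom := (Iso.inv_comp_eq _).1 h
      have h'' := congr_arg (· ≫ (ψ (n + 1)).inv) h'
      simp only [Category.assoc, Iso.hom_inv_id, Category.comp_id] at h''
      exact ((Category.assoc _ _ _).trans h''.symm))
    exact ⟨(boundedComplexes C).ι.preimageIso ((HomotopyCategory.quotient C (.up ℤ)).mapIso e)⟩

/-- A localization with a calculus of left fractions has small Hom sets if the original category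
is essentially small and has small Hom sets. -/
lemma isUniverseCategory_localization {T : Type*} [Category* T] (hT : IsUniverseCategory U T)
    (hT' : IsEssentiallySmallIn U T) (W : MorphismProperty T) [W.HasLeftCalculusOfFractions]
    [W.RespectsIso] : IsUniverseCategory U W.Localization := by
  intro X Y
  obtain ⟨J, c, hJ, hc⟩ := hT'.exists_family
  obtain ⟨⟨X⟩⟩ := X
  obtain ⟨⟨Y⟩⟩ := Y
  change IsSmallIn U (W.Q.obj X ⟶ W.Q.obj Y)
  have h := hU.isSmallIn_sigma hJ (fun j ↦ hU.isSmallIn_prod (hT X (c j)) (hT Y (c j)))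
  have h' := hU.isSmallIn_of_injective h
    (Subtype.val : {p : Σ j, (X ⟶ c j) × (Y ⟶ c j) // W p.2.2} → _) Subtype.val_injective
  refine hU.isSmallIn_of_surjective h' (fun p ↦ W.Q.map p.1.2.1 ≫
    (Localization.isoOfHom W.Q W p.1.2.2 p.2).inv) (fun g ↦ ?_)
  obtain ⟨φ, hφ⟩ := Localization.exists_leftFraction W.Q W g
  obtain ⟨j, ⟨e⟩⟩ := hc φ.Y'
  have hs : W (φ.s ≫ e.hom) := (MorphismProperty.cancel_right_of_respectsIso W φ.s e.hom).2 φ.hs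
  refine ⟨⟨⟨j, φ.f ≫ e.hom, φ.s ≫ e.hom⟩, hs⟩, ?_⟩
  rw [Iso.comp_inv_eq, hφ]
  simp

end IsGrothendieckUniverse

end LocallySmall

/-! ### Smallness of the category `ExtTriv F I` and of its derived category -/

section ExtTrivSmall

variable {F : Type w} [Field F] {I : Type w}

/-- As a set, an object of `ExtTriv F I` is the product of a submodule and of the quotient by this
submodule. -/
lemma exists_equiv_of_isExtensionOfTrivial {M : ModuleCat.{w} (FreeAlgebra F I)}
    (hM : isExtensionOfTrivial F I M) :
    ∃ m n : ℕ, Nonempty (M ≃ (Fin m → F) × (Fin n → F)) := by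
  obtain ⟨N, ⟨m, ⟨e⟩⟩, n, ⟨e'⟩⟩ := hM
  exact ⟨n, m, ⟨(N.toAddSubgroup.addGroupEquivQuotientProdAddSubgroup).trans
    (Equiv.prodCongr e'.toEquiv e.toEquiv)⟩⟩

/-- An additive bijection between modules over a free algebra is linear if it commutes with the
action of the scalars and of the free generators. -/
lemma FreeAlgebra.map_smul_of_forall_ι {M N : Type*} [AddCommGroup M] [AddCommGroup N]
    [Module (FreeAlgebra F I) M] [Module (FreeAlgebra F I) N] (f : M →+ N)
    (hF : ∀ (c : F) m, f (algebraMap F (FreeAlgebra F I) c • m) =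
      algebraMap F (FreeAlgebra F I) c • f m)
    (hI : ∀ (i : I) m, f (FreeAlgebra.ι F i • m) = FreeAlgebra.ι F i • f m)
    (a : FreeAlgebra F I) (m : M) : f (a • m) = a • f m := by
  induction a using FreeAlgebra.induction generalizing m with
  | grade0 c => exact hF c m
  | grade1 i => exact hI i m
  | mul a b ha hb => rw [mul_smul, ha, hb, mul_smul]
  | add a b ha hb => rw [add_smul, map_add, ha, hb, add_smul]

namespace IsGrothendieckUniverse

variable {U : ZFSet.{w}} (hU : IsGrothendieckUniverse U)
include hU

lemma isSmallIn_prod_fin_fun (hω : ZFSet.omega ∈ U) {α : Type*} (hα : IsSmallIn U α) (m n : ℕ) :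
    IsSmallIn U ((Fin m → α) × (Fin n → α)) :=
  hU.isSmallIn_prod (hU.isSmallIn_fun (hU.isSmallIn_of_countable hω _) hα)
    (hU.isSmallIn_fun (hU.isSmallIn_of_countable hω _) hα)

lemma isUniverseCategory_extTriv (hω : ZFSet.omega ∈ U) (hF : IsSmallIn U F) :
    IsUniverseCategory U (ExtTriv F I) := by
  have h (M : ExtTriv F I) : IsSmallIn U M.obj := by
    obtain ⟨m, n, ⟨e⟩⟩ := exists_equiv_of_isExtensionOfTrivial M.property
    exact hU.isSmallIn_of_injective (hU.isSmallIn_prod_fin_fun hω hF m n) e e.injective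
  intro M N
  refine hU.isSmallIn_of_injective (hU.isSmallIn_fun (h M) (h N)) (fun f ↦ f.hom.hom)
    (fun f g hfg ↦ ?_)
  apply (isExtensionOfTrivial F I).ι.map_injective
  ext x
  exact congr_fun hfg x

lemma isEssentiallySmallIn_extTriv (hω : ZFSet.omega ∈ U) (hF : IsSmallIn U F)
    (hI : IsSmallIn U I) : IsEssentiallySmallIn U (ExtTriv F I) := by
  have h := hU.isSmallIn_prod_fin_fun hω hF
  -- a module is encoded by the addition, and by the actions of the scalars and of the generators,
  -- on a set of the form `F ^ m × F ^ n`
  refine hU.isEssentiallySmallIn_of_code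
    (hU.isSmallIn_sigma (hU.isSmallIn_of_countable hω (ℕ × ℕ))
      (fun p ↦ hU.isSmallIn_prod (hU.isSmallIn_fun (h p.1 p.2) (hU.isSmallIn_fun (h p.1 p.2)
        (h p.1 p.2))) (hU.isSmallIn_prod (hU.isSmallIn_fun hF (hU.isSmallIn_fun (h p.1 p.2)
          (h p.1 p.2))) (hU.isSmallIn_fun hI (hU.isSmallIn_fun (h p.1 p.2) (h p.1 p.2))))))
    (fun j M ↦ ∃ e : M.obj ≃ (Fin j.1.1 → F) × (Fin j.1.2 → F),
      (∀ x y, e (x + y) = j.2.1 (e x) (e y)) ∧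
      (∀ c x, e (algebraMap F (FreeAlgebra F I) c • x) = j.2.2.1 c (e x)) ∧
      (∀ i x, e (FreeAlgebra.ι F i • x) = j.2.2.2 i (e x))) (fun M ↦ ?_) ?_
  · obtain ⟨m, n, ⟨e⟩⟩ := exists_equiv_of_isExtensionOfTrivial M.property
    exact ⟨⟨(m, n), fun x y ↦ e (e.symm x + e.symm y),
      fun c x ↦ e (algebraMap F (FreeAlgebra F I) c • e.symm x),
      fun i x ↦ e (FreeAlgebra.ι F i • e.symm x)⟩, e, by simp, by simp, by simp⟩
  · rintro ⟨⟨m, n⟩, add, smul, act⟩ M N ⟨e, he₁, he₂, he₃⟩ ⟨e', he₁', he₂', he₃'⟩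
    let f : M.obj ≃+ N.obj :=
      { e.trans e'.symm with
        map_add' := fun x y ↦ e'.injective (by simp [he₁, he₁']) }
    have hf (x : M.obj) : e' (f x) = e x := e'.apply_symm_apply _
    let g : M.obj ≃ₗ[FreeAlgebra F I] N.obj :=
      { f with
        map_smul' := FreeAlgebra.map_smul_of_forall_ι f.toAddMonoidHom
          (fun c x ↦ e'.injective ((hf _).trans (by
            rw [he₂, he₂']
            exact congr_arg _ (hf x).symm)))
          (fun i x ↦ e'.injective ((hf _).trans (by
            rw [he₃, he₃']
            exact congr_arg _ (hf x).symm))) }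
    exact ⟨(isExtensionOfTrivial F I).ι.preimageIso g.toModuleIso⟩

lemma not_isSmallIn_fun {α β : Type*} [Nontrivial β] (hα : ¬ IsSmallIn U α) :
    ¬ IsSmallIn U (α → β) := by
  classical
  obtain ⟨b, b', hb⟩ := exists_pair_ne β
  refine fun h ↦ hα (hU.isSmallIn_of_injective h (fun a ↦ Function.update (fun _ ↦ b) a b') ?_)
  intro a a' h'
  by_contra hne
  have := congr_fun h' a
  simp [hne] at this
  exact hb this.symm

end IsGrothendieckUniverse

lemma IsSmallIn.mono {U V : ZFSet.{w}} (hUV : U ⊆ V) {α : Type*} (h : IsSmallIn U α) :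
    IsSmallIn V α := by
  obtain ⟨x, hx, e⟩ := h
  exact ⟨x, hUV hx, e⟩

variable (F I) in
/-- The Hom set from `h(F)` to `h(F⟦1⟧)` in `Ab(D^b(A))` is in bijection with `F ^ I`. -/
lemma not_isUniverseCategory_abelianisation_boundedDerivedCategory {U : ZFSet.{w}}
    (hU : IsGrothendieckUniverse U) (hI : ¬ IsSmallIn U I) :
    ¬ IsUniverseCategory U (Abelianisation (BoundedDerivedCategory (ExtTriv F I))) := by
  intro h
  obtain ⟨e⟩ := nonempty_homShift_trivialObject_addEquiv F I
  refine hU.not_isSmallIn_fun (β := F) hI (hU.isSmallIn_of_injective (h _ _)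
    (fun x ↦ (toAbelianisation (BoundedDerivedCategory (ExtTriv F I))).map (e.symm x)) ?_)
  exact (Functor.map_injective _).comp e.symm.injective

end ExtTrivSmall

theorem mainTheorem3 (U V : ZFSet.{w}) (hU : IsGrothendieckUniverse U)
    (hV : IsGrothendieckUniverse V) (hω : ZFSet.omega ∈ U) (hUV : U ⊆ V) (hne : U ≠ V)
    (F : Type w) [Field F] (hF : IsSmallIn U F)
    (I : Type w) (hIV : IsSmallIn V I) (hIU : ¬ IsSmallIn U I) :
    IsUniverseCategory U (Abelianisation (BoundedHomotopyCategory (ExtTriv F I))) ∧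
    (∃ (Φ : Abelianisation (BoundedHomotopyCategory (ExtTriv F I)) ⥤
          Abelianisation (BoundedDerivedCategory (ExtTriv F I)))
        (e : SerreQuotient (acyclicSerre (ExtTriv F I)) ≌
          Abelianisation (BoundedDerivedCategory (ExtTriv F I))),
      PreservesFiniteLimits Φ ∧ PreservesFiniteColimits Φ ∧
      Nonempty (toAbelianisation (BoundedHomotopyCategory (ExtTriv F I)) ⋙ Φ ≅
        (boundedAcyclic (ExtTriv F I)).trW.Q ⋙
          toAbelianisation (BoundedDerivedCategory (ExtTriv F I))) ∧
      Nonempty (serreQuotientFunctor (acyclicSerre (ExtTriv F I)) ⋙ e.functor ≅ Φ)) ∧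
    IsUniverseCategory V (SerreQuotient (acyclicSerre (ExtTriv F I))) ∧
    IsUniverseCategory V (Abelianisation (BoundedDerivedCategory (ExtTriv F I))) ∧
    Nonempty (Abelian.Ext (ModuleCat.of (FreeAlgebra F I) (TrivialModule F))
      (ModuleCat.of (FreeAlgebra F I) (TrivialModule F)) 1 ≃ₗ[F] (I → F)) ∧
    Nonempty ((inBoundedDerivedCategory (trivialObject F I) ⟶
      (inBoundedDerivedCategory (trivialObject F I))⟦(1 : ℤ)⟧) ≃+ (I → F)) ∧
    ¬ IsUniverseCategory U (SerreQuotient (acyclicSerre (ExtTriv F I))) ∧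
    ¬ IsUniverseCategory U (Abelianisation (BoundedDerivedCategory (ExtTriv F I))) := by
  obtain ⟨Φ, e, hΦ⟩ := exists_equivalence_serreQuotient_acyclicSerre (C := ExtTriv F I)
  have hF' := hF.mono hUV
  have hω' : ZFSet.omega ∈ V := hUV hω
  have hV₁ : IsUniverseCategory V (ExtTriv F I) := hV.isUniverseCategory_extTriv hω' hF'
  have hV₂ : IsUniverseCategory V (Abelianisation (BoundedDerivedCategory (ExtTriv F I))) :=
    hV.isUniverseCategory_abelianisation (hV.isUniverseCategory_localization
      (hV.isUniverseCategory_boundedHomotopyCategory hω' hV₁)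
      (hV.isEssentiallySmallIn_boundedHomotopyCategory hω' hV₁
        (hV.isEssentiallySmallIn_extTriv hω' hF' hIV)) _)
  have hU₂ := not_isUniverseCategory_abelianisation_boundedDerivedCategory F I hU hIU
  exact ⟨hU.isUniverseCategory_abelianisation (hU.isUniverseCategory_boundedHomotopyCategory hω
      (hU.isUniverseCategory_extTriv hω hF)), ⟨Φ, e, hΦ⟩,
    hV.isUniverseCategory_of_equivalence e hV₂, hV₂, ⟨extOneTrivialModuleEquiv F I⟩,
    nonempty_homShift_trivialObject_addEquiv F I,
    fun h ↦ hU₂ (hU.isUniverseCategory_of_equivalence e.symm h), hU₂⟩
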